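/- Let $M$ be a smooth (Hausdorff, finite-dimensional) manifold and let $(H,g)$ be a sub-semi-Riemannian structure on $M$: $H\subseteq TM$ is a smooth bracket generating distribution of constant (arbitrary) rank, and $g$ is a smooth field of nondegenerate symmetric bilinear forms on $H$. Let $\Gamma(H)$ denote the set of smooth vector fields with values in $H$, each defined on some open subset of $M$. Let $Z$ be a smooth vector field on $M$, let $\operatorname{ad}_Z X=[Z,X]$, and let $\psi^t$ be the maximal local flow of $Z$, defined on the set $D_t\subseteq M$ of the points whose maximal integral curve exists at time $t$. We write "$\operatorname{ad}_Z:\Gamma(H)\to\Gamma(H)$" if $[Z,X]\in\Gamma(H)$ for every $X\in\Gamma(H)$. A diffeomorphism $f:U\to f(U)$ between open subsets of $M$ is called conformal if $d_qf(H_q)\subseteq H_{f(q)}$ for every $q\in U$ and there is a smooth function $\rho>0$ on $U$ with $g(d_qf(v),d_qf(w))=\rho(q)\,g(v,w)$ for all $q\in U$ and $v,w\in H_q$; it is an isometry if this holds with $\rho=1$. The field $Z$ is an infinitesimal conformal transformation (resp. infinitesimal isometry) if for every $t\in\mathbb R$ the set $D_t$ is open and $\psi^t$ is a conformal diffeomorphism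 (resp. an isometry) of $D_t$ onto an open subset of $M$. Then: 1. $\operatorname{ad}_Z:\Gamma(H)\to\Gamma(H)$ if and only if $d_q\psi^t(H_q)\subseteq H_{\psi^t(q)}$ for every $t\in\mathbb R$ and every $q\in D_t$. In that case the restricted Lie derivative $$(\tilde L_Zg)_q(v,w)=\frac{d}{dt}\Big|_{t=0}\,g\big(d_q\psi^t(v),d_q\psi^t(w)\big)$$ exists for all $q\in M$ and $v,w\in H_q$. 2. $Z$ is an infinitesimal conformal transformation if and only if (i) $\operatorname{ad}_Z:\Gamma(H)\to\Gamma(H)$, and (ii) there is a function $\mu\in C^\infty(M)$ such that $\tilde L_Zg=\mu g$ on $H$. 3. $Z$ is an infinitesimal conformal transformation if and only if $\operatorname{ad}_Z:\Gamma(H)\to\Gamma(H)$ and there is a function $\mu\in C^\infty(M)$ such that $$Z(g(X,Y))=g(\operatorname{ad}_ZX,Y)+g(X,\operatorname{ad}_ZY)+\mu\,g(X,Y)$$ for all $X,Y\in\Gamma(H)$ (with a common domain). 4. $Z$ is an infinitesimal isometry if and only if $\operatorname{ad}_Z:\Gamma(H)\to\Gamma(H)$ and $$Z(g(X,Y))=g(\operatorname{ad}_ZX,Y)+g(X,\operatorname{ad}_ZY)$$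 for all $X,Y\in\Gamma(H)$ (with a common domain). -/

import Mathlib

open Set
open scoped Manifold ContDiff

noncomputable section

namespace SubSemiRiem

variable {E : Type*} [NormedAddCommGroup E] [NormedSpace ℝ E]
  {M : Type*} [TopologicalSpace M] [ChartedSpace E M]
  [IsManifold 𝓘(ℝ, E) ∞ M]

/-- `X` restricts to a smooth vector field on the open set `U`; its values outside `U` are
irrelevant. -/
def IsSmoothFieldOn (U : Set M) (X : (q : M) → TangentSpace 𝓘(ℝ, E) q) : Prop :=
  IsOpen U ∧ ContMDiffOn 𝓘(ℝ, E) 𝓘(ℝ, E).tangent ∞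
    (fun q => (⟨q, X q⟩ : TangentBundle 𝓘(ℝ, E) M)) U

/-- `X`, restricted to the open set `U`, is an element of `Γ(H)`: a smooth vector field on `U`
with values in the distribution `H`. -/
def IsHorizontalOn (H : (q : M) → Submodule ℝ (TangentSpace 𝓘(ℝ, E) q))
    (U : Set M) (X : (q : M) → TangentSpace 𝓘(ℝ, E) q) : Prop :=
  IsSmoothFieldOn U X ∧ ∀ q ∈ U, X q ∈ H q

/-- `H` is a smooth distribution of constant rank `k`: near every point it has a smooth
frame of `k` vector fields. -/
def IsSmoothDistribution (H : (q : M) → Submodule ℝ (TangentSpace 𝓘(ℝ, E) q)) (k : ℕ) : Prop :=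
  ∀ q : M, ∃ U : Set M, q ∈ U ∧ ∃ X : Fin k → (p : M) → TangentSpace 𝓘(ℝ, E) p,
    (∀ i, IsSmoothFieldOn U (X i)) ∧
    ∀ p ∈ U, LinearIndependent ℝ (fun i => X i p) ∧
      Submodule.span ℝ (range fun i => X i p) = H p

/-- The iterated brackets `X₁`, `[X₁, X₂]`, `[X₁, [X₂, X₃]]`, … of horizontal vector fields
on `U`. -/
inductive IsIteratedBracket (H : (q : M) → Submodule ℝ (TangentSpace 𝓘(ℝ, E) q)) (U : Set M) :
    ((q : M) → TangentSpace 𝓘(ℝ, E) q) → Prop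
  | horizontal {X : (q : M) → TangentSpace 𝓘(ℝ, E) q} (hX : IsHorizontalOn H U X) :
      IsIteratedBracket H U X
  | bracket {X Y : (q : M) → TangentSpace 𝓘(ℝ, E) q} (hX : IsHorizontalOn H U X)
      (hY : IsIteratedBracket H U Y) :
      IsIteratedBracket H U (VectorField.mlieBracket 𝓘(ℝ, E) X Y)

/-- `H` is bracket generating: at every point the values of the iterated brackets of local
horizontal vector fields span the tangent space. -/
def IsBracketGenerating (H : (q : M) → Submodule ℝ (TangentSpace 𝓘(ℝ, E) q)) : Prop :=
  ∀ q : M, Submodule.span ℝ {v : TangentSpace 𝓘(ℝ, E) q |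
    ∃ (U : Set M) (X : (p : M) → TangentSpace 𝓘(ℝ, E) p),
      q ∈ U ∧ IsIteratedBracket H U X ∧ X q = v} = ⊤

open Classical in
/-- A bilinear form on a subspace `W`, evaluated on vectors of the ambient space. The value `0`
outside `W` is only a default: it is not used on vectors of `W`. -/
def evalOn {V : Type*} [AddCommGroup V] [Module ℝ V] (W : Submodule ℝ V)
    (B : LinearMap.BilinForm ℝ W) (v w : V) : ℝ :=
  if h : v ∈ W ∧ w ∈ W then B ⟨v, h.1⟩ ⟨w, h.2⟩ else 0

variable (E M) in
/-- A sub-semi-Riemannian structure `(H, g)` on `M`: a smooth bracket generating distribution `H`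
of constant rank and a smooth field `g` of nondegenerate symmetric bilinear forms on `H`.
(The index of `g` is locally constant; nothing is assumed about it.) -/
structure SubSemiRiemannianStructure where
  H : (q : M) → Submodule ℝ (TangentSpace 𝓘(ℝ, E) q)
  rank : ℕ
  smooth_H : IsSmoothDistribution H rank
  bracketGenerating : IsBracketGenerating H
  g : (q : M) → LinearMap.BilinForm ℝ (H q)
  symm_g : ∀ q, (g q).IsSymm
  nondegenerate_g : ∀ q, (g q).Nondegenerate
  smooth_g : ∀ (U : Set M) (X Y : (q : M) → TangentSpace 𝓘(ℝ, E) q),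
    IsHorizontalOn H U X → IsHorizontalOn H U Y →
      ContMDiffOn 𝓘(ℝ, E) 𝓘(ℝ, ℝ) ∞ (fun q => evalOn (H q) (g q) (X q) (Y q)) U

/-- The number `g_q(v, w)`, for `v, w ∈ H_q`. -/
def SubSemiRiemannianStructure.metric (S : SubSemiRiemannianStructure E M) (q : M)
    (v w : TangentSpace 𝓘(ℝ, E) q) : ℝ :=
  evalOn (S.H q) (S.g q) v w

/-- There is an integral curve of `Z`, defined on an open interval containing `0` and `t`,
that is at `q` at time `0` and at `p` at time `t`. -/
def FlowsTo (Z : (q : M) → TangentSpace 𝓘(ℝ, E) q) (t : ℝ) (q p : M) : Prop :=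
  ∃ (γ : ℝ → M) (a b : ℝ), 0 ∈ Ioo a b ∧ t ∈ Ioo a b ∧
    IsMIntegralCurveOn γ Z (Ioo a b) ∧ γ 0 = q ∧ γ t = p

/-- The domain of `ψ^t`: the points whose maximal integral curve exists at time `t`. -/
def flowDomain (Z : (q : M) → TangentSpace 𝓘(ℝ, E) q) (t : ℝ) : Set M :=
  {q | ∃ p, FlowsTo Z t q p}

open Classical in
/-- The (maximal, local) flow `ψ^t` of `Z`, as a map on `flowDomain Z t`. The value `q` outside
that set is only a default. -/
def flow (Z : (q : M) → TangentSpace 𝓘(ℝ, E) q) (t : ℝ) (q : M) : M :=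
  if h : ∃ p, FlowsTo Z t q p then h.choose else q

/-- `f` restricts to a diffeomorphism of the open set `U` onto an open set. -/
def IsDiffeoOn (f : M → M) (U : Set M) : Prop :=
  IsOpen U ∧ IsOpen (f '' U) ∧ ContMDiffOn 𝓘(ℝ, E) 𝓘(ℝ, E) ∞ f U ∧
    ∃ h : M → M, ContMDiffOn 𝓘(ℝ, E) 𝓘(ℝ, E) ∞ h (f '' U) ∧ ∀ q ∈ U, h (f q) = q

/-- `d_q f (H_q) ⊆ H_{f(q)}` for all `q ∈ U`. -/
def PreservesOn (S : SubSemiRiemannianStructure E M) (f : M → M) (U : Set M) : Prop :=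
  ∀ q ∈ U, ∀ v ∈ S.H q, mfderiv 𝓘(ℝ, E) 𝓘(ℝ, E) f q v ∈ S.H (f q)

/-- `(f^* g)_q (v, w) = g_{f(q)} (d_q f(v), d_q f(w))`. -/
def pullbackMetric (S : SubSemiRiemannianStructure E M) (f : M → M) (q : M)
    (v w : TangentSpace 𝓘(ℝ, E) q) : ℝ :=
  S.metric (f q) (mfderiv 𝓘(ℝ, E) 𝓘(ℝ, E) f q v) (mfderiv 𝓘(ℝ, E) 𝓘(ℝ, E) f q w)

/-- `f : U → f(U)` is a conformal transformation between open subsets of `(M, H, g)`. -/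
def IsConformalOn (S : SubSemiRiemannianStructure E M) (f : M → M) (U : Set M) : Prop :=
  IsDiffeoOn (E := E) f U ∧ PreservesOn S f U ∧
    ∃ ρ : M → ℝ, ContMDiffOn 𝓘(ℝ, E) 𝓘(ℝ, ℝ) ∞ ρ U ∧ (∀ q ∈ U, 0 < ρ q) ∧
      ∀ q ∈ U, ∀ v ∈ S.H q, ∀ w ∈ S.H q, pullbackMetric S f q v w = ρ q * S.metric q v w

/-- `f : U → f(U)` is an isometry between open subsets of `(M, H, g)`. -/
def IsIsometryOn (S : SubSemiRiemannianStructure E M) (f : M → M) (U : Set M) : Prop :=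
  IsDiffeoOn (E := E) f U ∧ PreservesOn S f U ∧
    ∀ q ∈ U, ∀ v ∈ S.H q, ∀ w ∈ S.H q, pullbackMetric S f q v w = S.metric q v w

/-- The flow of `Z` consists of conformal transformations `ψ^t : D_t → ψ^t(D_t)`. -/
def IsInfinitesimalConformal (S : SubSemiRiemannianStructure E M)
    (Z : (q : M) → TangentSpace 𝓘(ℝ, E) q) : Prop :=
  ∀ t : ℝ, IsConformalOn S (flow Z t) (flowDomain Z t)

/-- The flow of `Z` consists of isometries `ψ^t : D_t → ψ^t(D_t)`. -/
def IsInfinitesimalIsometry (S : SubSemiRiemannianStructure E M)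
    (Z : (q : M) → TangentSpace 𝓘(ℝ, E) q) : Prop :=
  ∀ t : ℝ, IsIsometryOn S (flow Z t) (flowDomain Z t)

/-- `ad_Z : Γ(H) → Γ(H)`, where `ad_Z X = [Z, X]`. -/
def AdPreserves (S : SubSemiRiemannianStructure E M)
    (Z : (q : M) → TangentSpace 𝓘(ℝ, E) q) : Prop :=
  ∀ (U : Set M) (X : (q : M) → TangentSpace 𝓘(ℝ, E) q), IsHorizontalOn S.H U X →
    IsHorizontalOn S.H U (VectorField.mlieBracket 𝓘(ℝ, E) Z X)

/-- The restricted Lie derivative `(L̃_Z g)_q (v, w) = d/dt|_{t=0} ((ψ^t)^* g)_q (v, w)`,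
for `v, w ∈ H_q`. -/
def restrictedLieDeriv (S : SubSemiRiemannianStructure E M)
    (Z : (q : M) → TangentSpace 𝓘(ℝ, E) q) (q : M) (v w : TangentSpace 𝓘(ℝ, E) q) : ℝ :=
  deriv (fun t : ℝ => pullbackMetric S (flow Z t) q v w) 0

/-- The value at `q` of the derivative `Z(g(X, Y))` of the function `g(X, Y)` along `Z`. -/
def derivMetricAlong (S : SubSemiRiemannianStructure E M)
    (Z X Y : (q : M) → TangentSpace 𝓘(ℝ, E) q) (q : M) : ℝ :=
  mfderiv 𝓘(ℝ, E) 𝓘(ℝ, ℝ) (fun p => S.metric p (X p) (Y p)) q (Z q)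

end SubSemiRiem

end

/-! Everything is reduced to linear differential equations along integral curves, read in a chart.

In a chart, let `z` be the coordinate expression of `Z`. A horizontal frame and a dual coframe
present `H` as the range of smooth projections `P`, and `g` as the restriction to `H` of smooth
bilinear forms `G` (`exists_local_model`). Put `D = (1 - P) ∘ Dz - DP(z)`, which is `flowDefect`.
For horizontal `X`, differentiating `X = P X` gives `(1 - P)[z, X] = -D X`; for a vector `y`
transported by the linearized flow, `(1 - P) y` has derivative `D y`. So both sides of the first
equivalence say that `D` vanishes on `H`. If it does, `(1 - P) y` solves a homogeneous linear
equation with initial value zero, hence vanishes. This is local in time; `flow_induction` and the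
group law extend it to whole integral curves.

Once the flow preserves `H`, the derivative at time zero of the pulled back metric can be computed
with `G`, and equals `Z(g(X, Y)) - g([Z, X], Y) - g(X, [Z, Y])` (`hasDerivAt_pullbackMetric`). Thus
the condition on the restricted Lie derivative and the bracket identity are the same. If that
derivative is `μ g`, the group law turns it into a scalar linear equation along each integral curve,
whose solution is `exp(∫ μ) g` (`pullbackMetric_flow_eq_exp`); `μ = 0` gives isometries. Conversely,
conformal flows make the derivative proportional to `g`, and `μ` is recovered as a quotient of two
smooth functions.

The argument needs smooth dependence of the flow on the initial point and the linearized equation.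
`exists_local_flow` obtains both by applying the implicit function theorem to the integral equation
in a space of continuous curves. -/

noncomputable section

namespace SubSemiRiem

open Filter Topology

universe u

/-! ### Differentiability of composition operators on spaces of continuous functions. -/

section Nemytskii

/-- Pointwise application of a continuous family of operators to a continuous function. -/
def evalCLM (K : Type*) [TopologicalSpace K] [CompactSpace K] (E F : Type*)
    [NormedAddCommGroup E] [NormedSpace ℝ E] [NormedAddCommGroup F] [NormedSpace ℝ F]
    (A : C(K, E →L[ℝ] F)) : C(K, E) →L[ℝ] C(K, F) :=
  LinearMap.mkContinuous
    { toFun := fun h => (⟨fun k => A k (h k), by fun_prop⟩ : C(K, F))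
      map_add' := fun h h' => by ext; simp
      map_smul' := fun c h => by ext; simp } ‖A‖
    (fun h => by
      rw [ContinuousMap.norm_le _ (by positivity)]
      intro k
      exact ((A k).le_opNorm _).trans (mul_le_mul (A.norm_coe_le_norm k) (h.norm_coe_le_norm k)
        (norm_nonneg _) (norm_nonneg A)))

variable {K : Type*} [TopologicalSpace K] [CompactSpace K]

theorem isBoundedLinearMap_evalCLM {E F : Type*}
    [NormedAddCommGroup E] [NormedSpace ℝ E] [NormedAddCommGroup F] [NormedSpace ℝ F] :
    IsBoundedLinearMap ℝ (evalCLM K E F) where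
  map_add _ _ := rfl
  map_smul _ _ := rfl
  bound := ⟨1, one_pos, fun A => by
    rw [one_mul]
    exact LinearMap.mkContinuous_norm_le _ (norm_nonneg A) _⟩

/-- The range of `α` is compact, so `f'` varies by less than `c` within a distance `δ` of its
points, with `δ` independent of the point. The mean value inequality then bounds the remainder
uniformly in `k`. -/
theorem hasFDerivAt_postcomp {E F : Type*}
    [NormedAddCommGroup E] [NormedSpace ℝ E] [NormedAddCommGroup F] [NormedSpace ℝ F]
    {f : E → F} {f' : E → E →L[ℝ] F} (hf : ∀ x, HasFDerivAt f (f' x) x) (hc : Continuous f)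
    (hc' : Continuous f') (α : C(K, E)) :
    HasFDerivAt (fun β : C(K, E) => (⟨f, hc⟩ : C(E, F)).comp β)
      (evalCLM K E F ((⟨f', hc'⟩ : C(E, E →L[ℝ] F)).comp α)) α := by
  rw [hasFDerivAt_iff_isLittleO_nhds_zero, Asymptotics.isLittleO_iff]
  intro c hcpos
  have huc := (isCompact_range α.continuous).uniformContinuousAt_of_continuousAt f'
    (fun a _ => hc'.continuousAt) (Metric.dist_mem_uniformity hcpos)
  rw [Metric.mem_uniformity_dist] at huc
  obtain ⟨δ, hδ, H⟩ := huc
  filter_upwards [Metric.ball_mem_nhds (0 : C(K, E)) hδ] with h hh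
  rw [ContinuousMap.norm_le _ (by positivity)]
  intro k
  have hk : ‖h k‖ < δ := (h.norm_coe_le_norm k).trans_lt (by simpa using hh)
  have key : ‖f (α k + h k) - f (α k) - f' (α k) (α k + h k - α k)‖ ≤
      c * ‖α k + h k - α k‖ := by
    refine (convex_ball (α k) δ).norm_image_sub_le_of_norm_hasFDerivWithin_le'
      (f := f) (f' := f') (fun x _ => (hf x).hasFDerivWithinAt) (fun x hx => ?_)
      (Metric.mem_ball_self hδ) (by simpa using hk)
    have := H (a := α k) (b := x) (by rw [dist_comm]; exact hx) (mem_range_self k)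
    rw [← dist_eq_norm, dist_comm]
    exact le_of_lt this
  simp only [add_sub_cancel_left] at key
  exact key.trans (mul_le_mul_of_nonneg_left (h.norm_coe_le_norm k) hcpos.le)

/-- The derivative is composition with `f'` followed by a bounded linear map, so one derivative is
gained at each step of an induction. The induction replaces `F` by `E →L[ℝ] F`; the common universe
keeps this inside the statement. -/
theorem contDiff_postcomp {E : Type u} [NormedAddCommGroup E] [NormedSpace ℝ E] (n : ℕ)
    {F : Type u} [NormedAddCommGroup F] [NormedSpace ℝ F] {f : E → F} (hf : ContDiff ℝ n f) :
    ContDiff ℝ n (fun β : C(K, E) => (⟨f, hf.continuous⟩ : C(E, F)).comp β) := by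
  induction n generalizing F with
  | zero => exact contDiff_zero.2 (ContinuousMap.continuous_postcomp _)
  | succ n ih =>
    obtain ⟨f', h1, h2⟩ := contDiff_succ_iff_hasFDerivAt.1 hf
    have h3 := ih h1
    have h4 : ContDiff ℝ n (evalCLM K E F) := isBoundedLinearMap_evalCLM.contDiff
    exact contDiff_succ_iff_hasFDerivAt.2
      ⟨fun α => evalCLM K E F ((⟨f', h1.continuous⟩ : C(E, E →L[ℝ] F)).comp α),
        h4.comp h3,
        fun α => hasFDerivAt_postcomp h2 hf.continuous h1.continuous α⟩

end Nemytskii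

/-! ### Smooth dependence on initial values for ordinary differential equations. -/

section LocalFlow

variable {E : Type*} [NormedAddCommGroup E]

/-- The function `τ ↦ α τ` on `[-1, 1]`, extended by constants to the line. -/
def extendIcc (α : C(Icc (-1 : ℝ) 1, E)) (τ : ℝ) : E := IccExtend (by norm_num) α τ

theorem continuous_extendIcc (α : C(Icc (-1 : ℝ) 1, E)) : Continuous (extendIcc α) :=
  α.continuous.Icc_extend'

theorem extendIcc_of_mem (α : C(Icc (-1 : ℝ) 1, E)) {τ : ℝ} (hτ : τ ∈ Icc (-1 : ℝ) 1) :
    extendIcc α τ = α ⟨τ, hτ⟩ := IccExtend_of_mem _ _ hτ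

variable [NormedSpace ℝ E]

/-- `α ↦ (τ ↦ ∫₀^τ α)` on `C([-1, 1], E)`. -/
def volterra (E : Type*) [NormedAddCommGroup E] [NormedSpace ℝ E] :
    C(Icc (-1 : ℝ) 1, E) →L[ℝ] C(Icc (-1 : ℝ) 1, E) :=
  LinearMap.mkContinuous
    { toFun := fun α => ⟨fun τ => ∫ s in (0 : ℝ)..τ, extendIcc α s,
        (intervalIntegral.continuous_primitive
          (fun _ _ => (continuous_extendIcc α).intervalIntegrable _ _) 0).comp
            continuous_subtype_val⟩
      map_add' := fun α β => by
        ext τ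
        exact intervalIntegral.integral_add ((continuous_extendIcc α).intervalIntegrable _ _)
          ((continuous_extendIcc β).intervalIntegrable _ _)
      map_smul' := fun c α => by
        ext τ
        exact intervalIntegral.integral_smul c (extendIcc α) } 1
    (fun α => by
      rw [ContinuousMap.norm_le _ (by positivity)]
      intro τ
      have := intervalIntegral.norm_integral_le_of_norm_le_const (a := 0) (b := (τ : ℝ))
        (f := extendIcc α) (C := ‖α‖) (fun x _ => α.norm_coe_le_norm _)
      refine this.trans ?_
      rw [sub_zero, mul_comm]
      exact mul_le_mul_of_nonneg_right (abs_le.2 τ.2) (norm_nonneg _))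

theorem volterra_apply (α : C(Icc (-1 : ℝ) 1, E)) (τ : Icc (-1 : ℝ) 1) :
    volterra E α τ = ∫ s in (0 : ℝ)..τ, extendIcc α s := rfl

/-- A solution of `α = x + ε • ∫ β` is differentiable in the interior, with derivative
`ε • β`. -/
theorem hasDerivAt_of_eq_volterra [CompleteSpace E] {α β : C(Icc (-1 : ℝ) 1, E)} {x : E} {ε : ℝ}
    (h : α = ContinuousMap.const _ x + ε • volterra E β) {τ : ℝ} (hτ : τ ∈ Ioo (-1 : ℝ) 1) :
    HasDerivAt (extendIcc α) (ε • extendIcc β τ) τ := by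
  have h1 : HasDerivAt (fun τ : ℝ => x + ε • ∫ s in (0 : ℝ)..τ, extendIcc β s)
      (ε • extendIcc β τ) τ :=
    ((intervalIntegral.integral_hasDerivAt_right
      ((continuous_extendIcc β).intervalIntegrable _ _)
      ((continuous_extendIcc β).stronglyMeasurableAtFilter _ _)
      (continuous_extendIcc β).continuousAt).const_smul ε).const_add x
  refine h1.congr_of_eventuallyEq ?_
  filter_upwards [Ioo_mem_nhds hτ.1 hτ.2] with s hs
  rw [extendIcc_of_mem α (Ioo_subset_Icc_self hs)]
  conv_lhs => rw [h]
  rfl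

/-- `x ↦ const x` as a continuous linear map into `C([-1, 1], E)`. -/
def constIcc (E : Type*) [NormedAddCommGroup E] [NormedSpace ℝ E] :
    E →L[ℝ] C(Icc (-1 : ℝ) 1, E) :=
  LinearMap.mkContinuous
    { toFun := fun x => ContinuousMap.const _ x
      map_add' := fun _ _ => rfl
      map_smul' := fun _ _ => rfl } 1
    (fun x => by
      rw [ContinuousMap.norm_le _ (by positivity)]
      intro τ
      exact (one_mul ‖x‖).ge)

theorem constIcc_apply (x : E) (τ : Icc (-1 : ℝ) 1) : constIcc E x τ = x := rfl

end LocalFlow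

/-- The local flow of a smooth vector field depends smoothly on the initial point, and its
derivative solves the linearized equation. -/
theorem exists_local_flow {E : Type u} [NormedAddCommGroup E] [NormedSpace ℝ E] [CompleteSpace E]
    {f : E → E} {n : ℕ} (hn : n ≠ 0) (hf : ContDiff ℝ n f) (x₀ : E) {V : Set E} (hV : V ∈ 𝓝 x₀) :
    ∃ ε > 0, ∃ W : Set E, IsOpen W ∧ x₀ ∈ W ∧ ∃ Φ : ℝ → E → E, ∀ x ∈ W, Φ 0 x = x ∧
      ∀ t ∈ Ioo (-ε) ε, Φ t x ∈ V ∧ HasDerivAt (fun s => Φ s x) (f (Φ t x)) t ∧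
        ContDiffAt ℝ n (Φ t) x ∧
        ∀ v, HasDerivAt (fun s => fderiv ℝ (Φ s) x v)
          (fderiv ℝ f (Φ t x) (fderiv ℝ (Φ t) x v)) t := by
  have hn1 : (1 : WithTop ℕ∞) ≤ n := by exact_mod_cast Nat.one_le_iff_ne_zero.2 hn
  have hn0 : (n : WithTop ℕ∞) ≠ 0 := by exact_mod_cast hn
  let N : C(Icc (-1 : ℝ) 1, E) → C(Icc (-1 : ℝ) 1, E) :=
    fun β => (⟨f, hf.continuous⟩ : C(E, E)).comp β
  have hN : ContDiff ℝ n N := contDiff_postcomp n hf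
  have hf' : Continuous (fderiv ℝ f) := hf.continuous_fderiv hn0
  have hNd : ∀ α, HasFDerivAt N (evalCLM _ E E ((⟨fderiv ℝ f, hf'⟩ : C(E, E →L[ℝ] E)).comp α)) α :=
    hasFDerivAt_postcomp (fun x => (hf.differentiable hn0 x).hasFDerivAt) hf.continuous hf'
  -- Time is rescaled from `[-ε, ε]` to `[-1, 1]`, so that `ε` becomes a parameter: a zero of `G` is
  -- a solution of `α = x + ε ∫ f(α)`.
  let G : (ℝ × E) × C(Icc (-1 : ℝ) 1, E) → C(Icc (-1 : ℝ) 1, E) :=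
    fun p => p.2 - constIcc E p.1.2 - p.1.1 • volterra E (N p.2)
  have hG : ContDiff ℝ n G := by
    have h1 : ContDiff ℝ n (fun p : (ℝ × E) × C(Icc (-1 : ℝ) 1, E) => volterra E (N p.2)) :=
      (volterra E).contDiff.comp (hN.comp contDiff_snd)
    have h2 : ContDiff ℝ n (fun p : (ℝ × E) × C(Icc (-1 : ℝ) 1, E) => constIcc E p.1.2) :=
      (constIcc E).contDiff.comp (contDiff_snd.comp contDiff_fst)
    exact (contDiff_snd.sub h2).sub ((contDiff_fst.comp contDiff_fst).smul h1)
  let u : (ℝ × E) × C(Icc (-1 : ℝ) 1, E) := ((0, x₀), constIcc E x₀)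
  have hGu : G u = 0 := by simp [G, u]
  have hinv : (fderiv ℝ G u ∘L .inr ℝ (ℝ × E) C(Icc (-1 : ℝ) 1, E)).IsInvertible := by
    have h1 : HasFDerivAt (fun β => G (u.1, β))
        (fderiv ℝ G u ∘L .inr ℝ (ℝ × E) C(Icc (-1 : ℝ) 1, E)) u.2 :=
      ((hG.differentiable hn0 u).hasFDerivAt).comp u.2 (hasFDerivAt_prodMk_right u.1 u.2)
    -- At `ε = 0` the integral disappears, and the partial derivative in the curve is the identity.
    have h2 : HasFDerivAt (fun β => G (u.1, β))
        (ContinuousLinearMap.id ℝ C(Icc (-1 : ℝ) 1, E)) u.2 := by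
      have : (fun β => G (u.1, β)) = fun β => β - constIcc E x₀ := by
        funext β; simp [G, u]
      rw [this]
      exact (hasFDerivAt_id _).sub_const _
    rw [h1.unique h2]
    exact ⟨ContinuousLinearEquiv.refl ℝ _, rfl⟩
  let ψ := (hG.contDiffAt (x := u)).implicitFunction hn0 hinv
  have hψ : ContDiffAt ℝ n ψ u.1 := ContDiffAt.contDiffAt_implicitFunction _ _ _
  have hψu : ψ u.1 = constIcc E x₀ := ContDiffAt.implicitFunction_apply_self _ _ _
  have e1 : ∀ᶠ p in 𝓝 u.1, G (p, ψ p) = 0 := by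
    have := ContDiffAt.eventually_apply_implicitFunction (hG.contDiffAt (x := u)) hn0 hinv
    rwa [hGu] at this
  -- Being `C^n` at a point is an open condition because `n` is finite; the case `∞` is recovered
  -- only in `contMDiffAt_flow`.
  have e2 : ∀ᶠ p in 𝓝 u.1, ContDiffAt ℝ n ψ p := hψ.eventually (by simp)
  obtain ⟨δ, hδ, hδV⟩ := Metric.mem_nhds_iff.1 hV
  have e3 : ∀ᶠ p in 𝓝 u.1, ∀ k, ψ p k ∈ V := by
    have : ∀ᶠ p in 𝓝 u.1, ψ p ∈ Metric.ball (ψ u.1) δ :=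
      hψ.continuousAt.eventually (Metric.ball_mem_nhds _ hδ)
    filter_upwards [this] with p hp k
    apply hδV
    rw [hψu] at hp
    exact (ContinuousMap.dist_apply_le_dist (f := ψ p) (g := constIcc E x₀) k).trans_lt hp
  obtain ⟨A, hA, B, hB, hAB⟩ := mem_nhds_prod_iff.1 (e1.and (e2.and e3))
  obtain ⟨r, hr, hrA⟩ := Metric.mem_nhds_iff.1 hA
  obtain ⟨W, hWB, hW, hxW⟩ := mem_nhds_iff.1 hB
  let ε := r / 2
  have hε : 0 < ε := half_pos hr
  let α : E → C(Icc (-1 : ℝ) 1, E) := fun x => ψ (ε, x)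
  have hmem : ∀ x ∈ W, G ((ε, x), α x) = 0 ∧ ContDiffAt ℝ n ψ (ε, x) ∧ ∀ k, α x k ∈ V := by
    intro x hx
    refine hAB (Set.mk_mem_prod (hrA ?_) (hWB hx))
    rw [Metric.mem_ball, Real.dist_eq, sub_zero, abs_of_pos hε]
    exact half_lt_self hr
  have hα : ∀ x ∈ W, α x = constIcc E x + ε • volterra E (N (α x)) := by
    intro x hx
    have := (hmem x hx).1
    simp only [G] at this
    rw [sub_sub, sub_eq_zero] at this
    exact this
  have hαd : ∀ x ∈ W, ContDiffAt ℝ n α x := fun x hx =>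
    (hmem x hx).2.1.comp x (contDiffAt_const.prodMk contDiffAt_id)
  -- Differentiating the integral equation in `x` gives an integral equation of the same shape for
  -- the derivative, hence the linearized differential equation.
  have hαf : ∀ x ∈ W, ∀ v, fderiv ℝ α x v = constIcc E v + ε • volterra E
      (evalCLM _ E E ((⟨fderiv ℝ f, hf'⟩ : C(E, E →L[ℝ] E)).comp (α x)) (fderiv ℝ α x v)) := by
    intro x hx v
    have h1 := ((hαd x hx).differentiableAt hn0).hasFDerivAt
    have h2 := ((constIcc E).hasFDerivAt (x := x)).add
      ((((volterra E).hasFDerivAt (x := N (α x))).comp x ((hNd (α x)).comp x h1)).const_smul ε)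
    have h3 := h2.congr_of_eventuallyEq (f₁ := α) (by
      filter_upwards [hW.mem_nhds hx] with y hy
      exact hα y hy)
    exact congrArg (fun L : E →L[ℝ] C(Icc (-1 : ℝ) 1, E) => L v) h3.fderiv
  have hτ : ∀ t ∈ Ioo (-ε) ε, t / ε ∈ Ioo (-1 : ℝ) 1 := by
    intro t ht
    rw [mem_Ioo, lt_div_iff₀ hε, div_lt_iff₀ hε]
    exact ⟨by linarith [ht.1], by linarith [ht.2]⟩
  have hscale : ∀ (β γ : C(Icc (-1 : ℝ) 1, E)) (x : E),
      β = constIcc E x + ε • volterra E γ → ∀ t ∈ Ioo (-ε) ε,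
      HasDerivAt (fun s => extendIcc β (s / ε)) (extendIcc γ (t / ε)) t := by
    intro β γ x h t ht
    have h1 := hasDerivAt_of_eq_volterra h (hτ t ht)
    have h2 := h1.scomp t ((hasDerivAt_id t).div_const ε)
    rw [smul_smul, one_div_mul_cancel hε.ne', one_smul] at h2
    exact h2
  have hΦd : ∀ t, ∀ x ∈ W, ∀ v, fderiv ℝ (fun y => extendIcc (α y) (t / ε)) x v =
      extendIcc (fderiv ℝ α x v) (t / ε) := by
    intro t x hx v
    have h1 := ((hαd x hx).differentiableAt hn0).hasFDerivAt
    have h2 := ((ContinuousMap.evalCLM ℝ (projIcc (-1 : ℝ) 1 (by norm_num) (t / ε)) :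
      C(Icc (-1 : ℝ) 1, E) →L[ℝ] E).hasFDerivAt (x := α x)).comp x h1
    have h3 : HasFDerivAt (fun y => extendIcc (α y) (t / ε)) _ x := h2
    rw [h3.fderiv]
    rfl
  refine ⟨ε, hε, W, hW, hxW, fun t x => extendIcc (α x) (t / ε), fun x hx => ⟨?_, fun t ht =>
    ⟨(hmem x hx).2.2 _, hscale _ _ _ (hα x hx) t ht, ?_, fun v => ?_⟩⟩⟩
  · beta_reduce
    rw [zero_div, extendIcc_of_mem _ (by norm_num), hα x hx]
    simp [volterra_apply, constIcc_apply]
  · exact (ContinuousMap.evalCLM ℝ (projIcc (-1 : ℝ) 1 (by norm_num) (t / ε)) :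
      C(Icc (-1 : ℝ) 1, E) →L[ℝ] E).contDiff.contDiffAt.comp x (hαd x hx)
  · simp only [hΦd _ x hx v]
    exact hscale _ _ _ (hαf x hx v) t ht

end SubSemiRiem
end

/-! ### Vector fields, brackets and tangent maps in a chart. -/

noncomputable section

namespace SubSemiRiem

open Filter Topology

theorem two_le_minSmoothness_infty : minSmoothness ℝ 2 ≤ (∞ : WithTop ℕ∞) := by
  rw [minSmoothness_of_isRCLikeNormedField]
  exact WithTop.coe_le_coe.2 (le_top : (2 : ℕ∞) ≤ ⊤)

section Chart

variable {E : Type*} [NormedAddCommGroup E] [NormedSpace ℝ E]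
  {M : Type*} [TopologicalSpace M] [ChartedSpace E M]

/-- The derivative at `p` of the chart at `q₀`. -/
def chartDeriv (q₀ p : M) : TangentSpace 𝓘(ℝ, E) p →L[ℝ] E :=
  mfderiv 𝓘(ℝ, E) 𝓘(ℝ, E) (extChartAt 𝓘(ℝ, E) q₀) p

/-- The inverse of `chartDeriv`. -/
def chartDerivInv (q₀ p : M) : E →L[ℝ] TangentSpace 𝓘(ℝ, E) p :=
  (chartDeriv q₀ p).inverse

/-- The vector field `X` in the coordinates given by the chart at `q₀`. -/
def coordField (q₀ : M) (X : (p : M) → TangentSpace 𝓘(ℝ, E) p) (x : E) : E :=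
  chartDeriv q₀ ((extChartAt 𝓘(ℝ, E) q₀).symm x) (X ((extChartAt 𝓘(ℝ, E) q₀).symm x))

theorem coordField_chart {q₀ p : M} (hp : p ∈ (chartAt E q₀).source)
    (X : (p : M) → TangentSpace 𝓘(ℝ, E) p) :
    coordField q₀ X (extChartAt 𝓘(ℝ, E) q₀ p) = chartDeriv q₀ p (X p) := by
  unfold coordField
  rw [(extChartAt 𝓘(ℝ, E) q₀).left_inv (by rwa [extChartAt_source])]

variable [IsManifold 𝓘(ℝ, E) ∞ M]

variable (E M) in
theorem isManifold_of_le_infty (n : WithTop ℕ∞) (hn : n ≤ ∞) : IsManifold 𝓘(ℝ, E) n M :=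
  IsManifold.of_le hn

theorem isInvertible_chartDeriv {q₀ p : M} (hp : p ∈ (chartAt E q₀).source) :
    (chartDeriv (E := E) q₀ p).IsInvertible := by
  have : IsManifold 𝓘(ℝ, E) 1 M := isManifold_of_le_infty E M 1 (by simp)
  exact isInvertible_mfderiv_extChartAt (by rwa [extChartAt_source])

theorem chartDeriv_chartDerivInv {q₀ p : M} (hp : p ∈ (chartAt E q₀).source) (y : E) :
    chartDeriv q₀ p (chartDerivInv q₀ p y) = y :=
  (isInvertible_chartDeriv hp).self_apply_inverse y

theorem chartDerivInv_chartDeriv {q₀ p : M} (hp : p ∈ (chartAt E q₀).source)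
    (v : TangentSpace 𝓘(ℝ, E) p) :
    chartDerivInv q₀ p (chartDeriv q₀ p v) = v :=
  (isInvertible_chartDeriv hp).inverse_apply_self v

theorem contMDiffAt_field_iff {q₀ p : M} (hp : p ∈ (chartAt E q₀).source) {n : WithTop ℕ∞}
    (hn : n ≤ ∞) (X : (p : M) → TangentSpace 𝓘(ℝ, E) p) :
    ContMDiffAt 𝓘(ℝ, E) 𝓘(ℝ, E).tangent n
      (fun q => (⟨q, X q⟩ : TangentBundle 𝓘(ℝ, E) M)) p ↔
    ContMDiffAt 𝓘(ℝ, E) 𝓘(ℝ, E) n (fun q => chartDeriv q₀ q (X q)) p := by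
  have : IsManifold 𝓘(ℝ, E) (n + 1) M := isManifold_of_le_infty E M _ (by
    calc n + 1 ≤ ∞ + 1 := by gcongr
      _ = ∞ := rfl)
  have : IsManifold 𝓘(ℝ, E) 1 M := isManifold_of_le_infty E M 1 (by simp)
  have : ContMDiffVectorBundle n E (TangentSpace 𝓘(ℝ, E) : M → Type _) 𝓘(ℝ, E) :=
    TangentBundle.contMDiffVectorBundle
  have hb : p ∈ (trivializationAt E (TangentSpace 𝓘(ℝ, E)) q₀).baseSet := hp
  have := Bundle.Trivialization.contMDiffAt_section_iff (IB := 𝓘(ℝ, E)) (n := n) (s := X)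
    (trivializationAt E (TangentSpace 𝓘(ℝ, E)) q₀) hb
  refine this.trans (Filter.EventuallyEq.contMDiffAt_iff ?_)
  filter_upwards [(chartAt E q₀).open_source.mem_nhds hp] with q hq
  have h1 := TangentBundle.continuousLinearMapAt_trivializationAt (I := 𝓘(ℝ, E)) hq
  have h2 := Bundle.Trivialization.continuousLinearMapAt_apply_of_mem (R := ℝ)
    (trivializationAt E (TangentSpace 𝓘(ℝ, E)) q₀) (b := q) hq (X q)
  rw [← h2, h1]
  rfl

theorem contDiffAt_coordField {q₀ p : M} (hp : p ∈ (chartAt E q₀).source) {n : WithTop ℕ∞}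
    (hn : n ≤ ∞) {X : (p : M) → TangentSpace 𝓘(ℝ, E) p}
    (hX : ContMDiffAt 𝓘(ℝ, E) 𝓘(ℝ, E).tangent n
      (fun q => (⟨q, X q⟩ : TangentBundle 𝓘(ℝ, E) M)) p) :
    ContDiffAt ℝ n (coordField q₀ X) (extChartAt 𝓘(ℝ, E) q₀ p) := by
  have : IsManifold 𝓘(ℝ, E) n M := isManifold_of_le_infty E M _ hn
  have hp' : p ∈ (extChartAt 𝓘(ℝ, E) q₀).source := by rwa [extChartAt_source]
  have h1 := (contMDiffAt_field_iff hp hn X).1 hX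
  have h2 : ContMDiffAt 𝓘(ℝ, E) 𝓘(ℝ, E) n (extChartAt 𝓘(ℝ, E) q₀).symm
      (extChartAt 𝓘(ℝ, E) q₀ p) :=
    (contMDiffOn_extChartAt_symm q₀).contMDiffAt
      ((isOpen_extChartAt_target q₀).mem_nhds ((extChartAt 𝓘(ℝ, E) q₀).map_source hp'))
  rw [← (extChartAt 𝓘(ℝ, E) q₀).left_inv hp'] at h1
  exact (h1.comp _ h2).contDiffAt

/-- Near `p` a field is the pullback of its coordinate expression by the chart, and brackets commute
with pullbacks. Here the chart is centred at `q₀`, not at `p`, so that one chart serves a whole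
neighbourhood. -/
theorem chartDeriv_mlieBracket [CompleteSpace E] {q₀ p : M} (hp : p ∈ (chartAt E q₀).source)
    {V W : (p : M) → TangentSpace 𝓘(ℝ, E) p}
    (hV : ContMDiffAt 𝓘(ℝ, E) 𝓘(ℝ, E).tangent ∞
      (fun q => (⟨q, V q⟩ : TangentBundle 𝓘(ℝ, E) M)) p)
    (hW : ContMDiffAt 𝓘(ℝ, E) 𝓘(ℝ, E).tangent ∞
      (fun q => (⟨q, W q⟩ : TangentBundle 𝓘(ℝ, E) M)) p) :
    chartDeriv q₀ p (VectorField.mlieBracket 𝓘(ℝ, E) V W p) =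
      VectorField.lieBracket ℝ (coordField q₀ V) (coordField q₀ W)
        (extChartAt 𝓘(ℝ, E) q₀ p) := by
  have : IsManifold 𝓘(ℝ, E) (minSmoothness ℝ 2) M := isManifold_of_le_infty E M _ two_le_minSmoothness_infty
  have hpull : ∀ X : (p : M) → TangentSpace 𝓘(ℝ, E) p,
      VectorField.mpullback 𝓘(ℝ, E) 𝓘(ℝ, E) (extChartAt 𝓘(ℝ, E) q₀) (coordField q₀ X) =ᶠ[𝓝 p]
        X := by
    intro X
    filter_upwards [(chartAt E q₀).open_source.mem_nhds hp] with q hq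
    change chartDerivInv q₀ q (coordField q₀ X (extChartAt 𝓘(ℝ, E) q₀ q)) = X q
    rw [coordField_chart hq X]
    exact chartDerivInv_chartDeriv hq (X q)
  have hmd : ∀ {X : (p : M) → TangentSpace 𝓘(ℝ, E) p},
      ContMDiffAt 𝓘(ℝ, E) 𝓘(ℝ, E).tangent ∞
        (fun q => (⟨q, X q⟩ : TangentBundle 𝓘(ℝ, E) M)) p →
      MDifferentiableAt 𝓘(ℝ, E) 𝓘(ℝ, E).tangent
        (fun x : E => (⟨x, coordField (E := E) q₀ X x⟩ : TangentBundle 𝓘(ℝ, E) E))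
        (extChartAt 𝓘(ℝ, E) q₀ p) := fun hX =>
    (contMDiffAt_vectorSpace_iff_contDiffAt.2
      (contDiffAt_coordField hp le_rfl hX)).mdifferentiableAt (by simp)
  have h1 := VectorField.mpullback_mlieBracket (n := ∞) (hmd hV) (hmd hW)
    (contMDiffAt_extChartAt' hp) two_le_minSmoothness_infty
  rw [(hpull V).mlieBracket_vectorField_eq (hpull W)] at h1
  have h2 : ∀ V W : (x : E) → TangentSpace 𝓘(ℝ, E) x,
      VectorField.mlieBracket 𝓘(ℝ, E) V W = VectorField.lieBracket ℝ V W := fun V W => by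
    rw [← VectorField.mlieBracketWithin_univ, VectorField.mlieBracketWithin_eq_lieBracketWithin]
    exact VectorField.lieBracketWithin_univ
  rw [← h1]
  exact (chartDeriv_chartDerivInv hp _).trans (congrFun (h2 _ _) _)

theorem hasMFDerivAt_chart {q₀ p : M} (hp : p ∈ (chartAt E q₀).source) :
    HasMFDerivAt 𝓘(ℝ, E) 𝓘(ℝ, E) (extChartAt 𝓘(ℝ, E) q₀) p (chartDeriv (E := E) q₀ p) := by
  have : IsManifold 𝓘(ℝ, E) 1 M := isManifold_of_le_infty E M 1 (by simp)
  exact (mdifferentiableAt_extChartAt hp).hasMFDerivAt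

theorem hasMFDerivAt_chart_symm {q₀ p : M} (hp : p ∈ (chartAt E q₀).source) :
    HasMFDerivAt 𝓘(ℝ, E) 𝓘(ℝ, E) (extChartAt 𝓘(ℝ, E) q₀).symm (extChartAt 𝓘(ℝ, E) q₀ p)
      (mfderiv 𝓘(ℝ, E) 𝓘(ℝ, E) (extChartAt 𝓘(ℝ, E) q₀).symm (extChartAt 𝓘(ℝ, E) q₀ p)) := by
  have : IsManifold 𝓘(ℝ, E) 1 M := isManifold_of_le_infty E M 1 (by simp)
  have hp' : p ∈ (extChartAt 𝓘(ℝ, E) q₀).source := by rwa [extChartAt_source]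
  exact ((contMDiffOn_extChartAt_symm (n := 1) q₀).contMDiffAt
      ((isOpen_extChartAt_target q₀).mem_nhds ((extChartAt 𝓘(ℝ, E) q₀).map_source
        hp'))).mdifferentiableAt one_ne_zero |>.hasMFDerivAt

theorem mfderiv_chart_symm_chartDeriv {q₀ p : M} (hp : p ∈ (chartAt E q₀).source)
    (v : TangentSpace 𝓘(ℝ, E) p) :
    mfderiv 𝓘(ℝ, E) 𝓘(ℝ, E) (extChartAt 𝓘(ℝ, E) q₀).symm (extChartAt 𝓘(ℝ, E) q₀ p)
      (chartDeriv (E := E) q₀ p v) = (v : E) := by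
  have h1 := (hasMFDerivAt_chart_symm hp).comp p (hasMFDerivAt_chart hp)
  have h2 : HasMFDerivAt 𝓘(ℝ, E) 𝓘(ℝ, E)
      ((extChartAt 𝓘(ℝ, E) q₀).symm ∘ extChartAt 𝓘(ℝ, E) q₀) p
      (ContinuousLinearMap.id ℝ (TangentSpace 𝓘(ℝ, E) p)) := by
    refine (hasMFDerivAt_id p).congr_of_eventuallyEq ?_
    filter_upwards [(chartAt E q₀).open_source.mem_nhds hp] with q hq
    exact (extChartAt 𝓘(ℝ, E) q₀).left_inv (by rwa [extChartAt_source])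
  exact congrArg (fun L : E →L[ℝ] E => L v) (hasMFDerivAt_unique h1 h2)

theorem hasMFDerivAt_chart_symm_curve {q₀ : M} {Z : (p : M) → TangentSpace 𝓘(ℝ, E) p}
    {c : ℝ → E} {t : ℝ} (hc : HasDerivAt c (coordField q₀ Z (c t)) t)
    (ht : c t ∈ (extChartAt 𝓘(ℝ, E) q₀).target) :
    HasMFDerivAt 𝓘(ℝ, ℝ) 𝓘(ℝ, E) (fun s => (extChartAt 𝓘(ℝ, E) q₀).symm (c s)) t
      ((1 : ℝ →L[ℝ] ℝ).smulRight (Z ((extChartAt 𝓘(ℝ, E) q₀).symm (c t)))) := by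
  have hp : (extChartAt 𝓘(ℝ, E) q₀).symm (c t) ∈ (chartAt E q₀).source := by
    rw [← extChartAt_source 𝓘(ℝ, E)]
    exact (extChartAt 𝓘(ℝ, E) q₀).map_target ht
  have hpc := (extChartAt 𝓘(ℝ, E) q₀).right_inv ht
  have h1 := hasMFDerivAt_chart_symm hp
  have h3 := mfderiv_chart_symm_chartDeriv hp (Z ((extChartAt 𝓘(ℝ, E) q₀).symm (c t)))
  rw [hpc] at h1 h3
  refine (h1.comp t hc.hasFDerivAt.hasMFDerivAt).congr_mfderiv ?_
  ext
  refine (ContinuousLinearMap.map_smul _ (1 : ℝ) _).trans ?_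
  exact congrArg (fun v : E => (1 : ℝ) • v) h3

theorem chartDeriv_mfderiv {q₀ q₁ p : M} {f : M → M} (hp : p ∈ (chartAt E q₀).source)
    (hfp : f p ∈ (chartAt E q₁).source) (hf : MDifferentiableAt 𝓘(ℝ, E) 𝓘(ℝ, E) f p) {F : E → E}
    (hF : DifferentiableAt ℝ F (extChartAt 𝓘(ℝ, E) q₀ p))
    (hfF : (fun q => extChartAt 𝓘(ℝ, E) q₁ (f q)) =ᶠ[𝓝 p] fun q => F (extChartAt 𝓘(ℝ, E) q₀ q))
    (v : TangentSpace 𝓘(ℝ, E) p) :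
    chartDeriv q₁ (f p) (mfderiv 𝓘(ℝ, E) 𝓘(ℝ, E) f p v) =
      fderiv ℝ F (extChartAt 𝓘(ℝ, E) q₀ p) (chartDeriv q₀ p v) := by
  have h1 := (hasMFDerivAt_chart hfp).comp p hf.hasMFDerivAt
  have h2 := (hF.hasFDerivAt.hasMFDerivAt.comp p (hasMFDerivAt_chart hp)).congr_of_eventuallyEq hfF
  exact congrArg (fun L : E →L[ℝ] E => L v) (hasMFDerivAt_unique h1 h2)

end Chart

end SubSemiRiem
end

/-! ### The maximal local flow on a manifold: group law, open domains, smoothness. -/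

noncomputable section

namespace SubSemiRiem

open Filter Topology

/-- A map that is smooth near a point agrees near this point with a globally smooth map. -/
theorem exists_contDiff_eventuallyEq {E F : Type*} [NormedAddCommGroup E] [NormedSpace ℝ E]
    [FiniteDimensional ℝ E] [NormedAddCommGroup F] [NormedSpace ℝ F] {f : E → F} {x₀ : E}
    (hf : ∀ᶠ x in 𝓝 x₀, ContDiffAt ℝ ∞ f x) :
    ∃ g : E → F, ContDiff ℝ ∞ g ∧ g =ᶠ[𝓝 x₀] f := by
  obtain ⟨r, hr, hrf⟩ := Metric.nhds_basis_closedBall.eventually_iff.1 hf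
  let b : ContDiffBump x₀ := ⟨r / 2, r, half_pos hr, half_lt_self hr⟩
  refine ⟨fun x => b x • f x, contDiff_iff_contDiffAt.2 fun x => ?_, ?_⟩
  · by_cases hx : x ∈ Metric.closedBall x₀ r
    · exact b.contDiff.contDiffAt.smul (hrf hx)
    · refine (contDiffAt_const (c := (0 : F))).congr_of_eventuallyEq ?_
      filter_upwards [Metric.isClosed_closedBall.isOpen_compl.mem_nhds hx] with y hy
      have : b y = 0 := b.zero_of_le_dist (by
        simp only [mem_compl_iff, Metric.mem_closedBall, not_le] at hy
        exact hy.le)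
      rw [this, zero_smul]
  · filter_upwards [b.eventuallyEq_one] with x hx
    rw [hx, Pi.one_apply, one_smul]

variable {E : Type*} [NormedAddCommGroup E] [NormedSpace ℝ E] [FiniteDimensional ℝ E]
  {M : Type*} [TopologicalSpace M] [ChartedSpace E M] [IsManifold 𝓘(ℝ, E) ∞ M] [T2Space M]
  {Z : (q : M) → TangentSpace 𝓘(ℝ, E) q}

section FlowsTo

omit [FiniteDimensional ℝ E] [IsManifold 𝓘(ℝ, E) ∞ M] [T2Space M] in
theorem flowsTo_of_isMIntegralCurveOn {γ : ℝ → M} {a b s t : ℝ}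
    (hγ : IsMIntegralCurveOn γ Z (Ioo a b)) (hs : s ∈ Ioo a b) (ht : t ∈ Ioo a b) :
    FlowsTo Z (t - s) (γ s) (γ t) := by
  refine ⟨γ ∘ (· + s), a - s, b - s, ?_, ?_, ?_, ?_, ?_⟩
  · exact ⟨by linarith [hs.1], by linarith [hs.2]⟩
  · exact ⟨by linarith [ht.1], by linarith [ht.2]⟩
  · refine (hγ.comp_add s).mono fun x hx => ?_
    exact ⟨by linarith [hx.1], by linarith [hx.2]⟩
  · simp
  · simp

omit [FiniteDimensional ℝ E] [IsManifold 𝓘(ℝ, E) ∞ M] [T2Space M] in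
theorem FlowsTo.symm {t : ℝ} {q p : M} (h : FlowsTo Z t q p) : FlowsTo Z (-t) p q := by
  obtain ⟨γ, a, b, h0, ht, hγ, rfl, rfl⟩ := h
  simpa using flowsTo_of_isMIntegralCurveOn hγ ht h0

variable (hZ : ContMDiff 𝓘(ℝ, E) 𝓘(ℝ, E).tangent ∞
  (fun q => (⟨q, Z q⟩ : TangentBundle 𝓘(ℝ, E) M)))
include hZ

-- After a shift of the second curve by `s`, both integral curves pass through `p` at time `s`.
-- Since `M` is Hausdorff, they agree where both are defined and can be glued.
omit [FiniteDimensional ℝ E] in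
theorem FlowsTo.trans {s t : ℝ} {q p r : M} (h1 : FlowsTo Z s q p) (h2 : FlowsTo Z t p r) :
    FlowsTo Z (s + t) q r := by
  have : IsManifold 𝓘(ℝ, E) 1 M := isManifold_of_le_infty E M 1 (by simp)
  have hZ1 := hZ.of_le (m := 1) (by simp)
  obtain ⟨γ, a, b, h0, hs, hγ, rfl, rfl⟩ := h1
  obtain ⟨δ, c, d, h0', ht, hδ, h3, rfl⟩ := h2
  have hδ' : IsMIntegralCurveOn (δ ∘ (· + -s)) Z (Ioo (c + s) (d + s)) :=
    (hδ.comp_add (-s)).mono fun x hx => ⟨by linarith [hx.1], by linarith [hx.2]⟩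
  have hs' : s ∈ Ioo (c + s) (d + s) := ⟨by linarith [h0'.1], by linarith [h0'.2]⟩
  have heq : γ s = (δ ∘ (· + -s)) s := by simp [h3]
  classical
  have hp := isMIntegralCurveOn_piecewise hZ1 hγ hδ' ⟨hs, hs'⟩ heq
  have he := eqOn_piecewise_of_isMIntegralCurveOn_Ioo hZ1 hγ hδ' ⟨hs, hs'⟩ heq
  refine ⟨_, min a (c + s), max b (d + s), ?_, ?_, hp.mono fun x hx => ?_, ?_, ?_⟩
  · exact ⟨(min_le_left _ _).trans_lt h0.1, h0.2.trans_le (le_max_left _ _)⟩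
  · exact ⟨(min_le_right _ _).trans_lt (by linarith [ht.1]),
      lt_of_lt_of_le (by linarith [ht.2]) (le_max_right _ _)⟩
  · rcases le_total x s with h | h
    · rcases min_lt_iff.1 hx.1 with h' | h'
      · exact Or.inl ⟨h', h.trans_lt hs.2⟩
      · exact Or.inr ⟨h', h.trans_lt hs'.2⟩
    · rcases lt_max_iff.1 hx.2 with h' | h'
      · exact Or.inl ⟨hs.1.trans_le h, h'⟩
      · exact Or.inr ⟨hs'.1.trans_le h, h'⟩
  · exact piecewise_eq_of_mem _ _ _ h0
  · rw [he (show s + t ∈ Ioo (c + s) (d + s) from ⟨by linarith [ht.1], by linarith [ht.2]⟩)]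
    simp

omit [FiniteDimensional ℝ E] in
theorem FlowsTo.unique {t : ℝ} {q p r : M} (h1 : FlowsTo Z t q p) (h2 : FlowsTo Z t q r) :
    p = r := by
  have : IsManifold 𝓘(ℝ, E) 1 M := isManifold_of_le_infty E M 1 (by simp)
  have hZ1 := hZ.of_le (m := 1) (by simp)
  obtain ⟨γ, a, b, h0, ht, hγ, rfl, rfl⟩ := h1
  obtain ⟨δ, c, d, h0', ht', hδ, h3, rfl⟩ := h2
  classical
  have he := eqOn_piecewise_of_isMIntegralCurveOn_Ioo hZ1 hγ hδ ⟨h0, h0'⟩ h3.symm ht'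
  rw [piecewise_eq_of_mem _ _ _ ht] at he
  exact he

omit [FiniteDimensional ℝ E] in
theorem FlowsTo.flow_eq {t : ℝ} {q p : M} (h : FlowsTo Z t q p) : flow Z t q = p := by
  have hex : ∃ p, FlowsTo Z t q p := ⟨p, h⟩
  unfold flow
  rw [dif_pos hex]
  exact hex.choose_spec.unique hZ h

omit [FiniteDimensional ℝ E] in
theorem flowsTo_flow {t : ℝ} {q : M} (h : q ∈ flowDomain Z t) : FlowsTo Z t q (flow Z t q) := by
  obtain ⟨p, hp⟩ := h
  rwa [hp.flow_eq hZ]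

/-- The local flow of a smooth vector field on a manifold. -/
theorem exists_local_flow_of_contMDiff (q₀ : M) {n : ℕ} (hn : n ≠ 0) {V : Set M}
    (hV : V ∈ 𝓝 q₀) :
    ∃ ε > 0, ∃ W : Set M, IsOpen W ∧ q₀ ∈ W ∧ W ⊆ (chartAt E q₀).source ∧
      ∀ q ∈ W, ∀ t ∈ Ioo (-ε) ε, FlowsTo Z t q (flow Z t q) ∧ flow Z t q ∈ V ∧
        flow Z t q ∈ (chartAt E q₀).source ∧
        ContMDiffAt 𝓘(ℝ, E) 𝓘(ℝ, E) n (flow Z t) q ∧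
        HasDerivAt (fun s => extChartAt 𝓘(ℝ, E) q₀ (flow Z s q))
          (coordField q₀ Z (extChartAt 𝓘(ℝ, E) q₀ (flow Z t q))) t ∧
        ∀ v : TangentSpace 𝓘(ℝ, E) q,
          HasDerivAt (fun s => chartDeriv q₀ (flow Z s q) (mfderiv 𝓘(ℝ, E) 𝓘(ℝ, E) (flow Z s) q v))
            (fderiv ℝ (coordField q₀ Z) (extChartAt 𝓘(ℝ, E) q₀ (flow Z t q))
              (chartDeriv q₀ (flow Z t q) (mfderiv 𝓘(ℝ, E) 𝓘(ℝ, E) (flow Z t) q v))) t := by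
  have : IsManifold 𝓘(ℝ, E) n M := isManifold_of_le_infty E M n (by exact_mod_cast le_top)
  let φ := extChartAt 𝓘(ℝ, E) q₀
  have hsrc : φ.source = (chartAt E q₀).source := extChartAt_source _ q₀
  have hn0 : (n : WithTop ℕ∞) ≠ 0 := by exact_mod_cast hn
  have hq₀ : φ q₀ ∈ φ.target := φ.map_source (mem_extChartAt_source q₀)
  have hZt : ∀ x ∈ φ.target, ContDiffAt ℝ ∞ (coordField q₀ Z) x := by
    intro x hx
    rw [← φ.right_inv hx]
    exact contDiffAt_coordField (hsrc ▸ φ.map_target hx) le_rfl (hZ _)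
  have htn : φ.target ∈ 𝓝 (φ q₀) := (isOpen_extChartAt_target q₀).mem_nhds hq₀
  obtain ⟨f, hf, hfZ⟩ := exists_contDiff_eventuallyEq (Filter.eventually_of_mem htn hZt)
  -- The trajectories are confined to points where the globally defined `f` has the same germ as the
  -- coordinate field, so that both the values and the derivatives can be exchanged.
  have hVn : ∀ᶠ x in 𝓝 (φ q₀), x ∈ φ.target ∧ f =ᶠ[𝓝 x] coordField q₀ Z ∧ φ.symm x ∈ V := by
    refine (Filter.eventually_of_mem htn fun _ h => h).and (hfZ.eventuallyEq_nhds.and ?_)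
    refine (continuousAt_extChartAt_symm q₀).eventually ?_
    rwa [extChartAt_to_inv]
  obtain ⟨ε, hε, W', hW'o, hxW', Φ, hΦ⟩ := exists_local_flow hn
    (hf.of_le (by exact_mod_cast le_top)) (φ q₀) hVn
  have h0ε : (0 : ℝ) ∈ Ioo (-ε) ε := ⟨neg_lt_zero.2 hε, hε⟩
  let W := φ.source ∩ φ ⁻¹' W'
  have hWo : IsOpen W :=
    (continuousOn_extChartAt q₀).isOpen_inter_preimage (isOpen_extChartAt_source q₀) hW'o
  have hflows : ∀ q ∈ W, ∀ t ∈ Ioo (-ε) ε, FlowsTo Z t q (φ.symm (Φ t (φ q))) := by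
    intro q hq t ht
    refine ⟨fun s => φ.symm (Φ s (φ q)), -ε, ε, h0ε, ht, fun s hs => ?_, ?_, rfl⟩
    · obtain ⟨h1, h2, -⟩ := (hΦ _ hq.2).2 s hs
      refine (hasMFDerivAt_chart_symm_curve (q₀ := q₀) ?_ h1.1).hasMFDerivWithinAt
      rw [← h1.2.1.eq_of_nhds]
      exact h2
    · change φ.symm (Φ 0 (φ q)) = q
      rw [(hΦ _ hq.2).1, φ.left_inv hq.1]
  have hfl : ∀ q ∈ W, ∀ t ∈ Ioo (-ε) ε, flow Z t q = φ.symm (Φ t (φ q)) :=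
    fun q hq t ht => (hflows q hq t ht).flow_eq hZ
  have hφf : ∀ q ∈ W, ∀ t ∈ Ioo (-ε) ε, φ (flow Z t q) = Φ t (φ q) := by
    intro q hq t ht
    rw [hfl q hq t ht, φ.right_inv ((hΦ _ hq.2).2 t ht).1.1]
  have hfs : ∀ q ∈ W, ∀ t ∈ Ioo (-ε) ε, flow Z t q ∈ (chartAt E q₀).source := by
    intro q hq t ht
    rw [hfl q hq t ht, ← hsrc]
    exact φ.map_target ((hΦ _ hq.2).2 t ht).1.1
  have hsm : ∀ q ∈ W, ∀ t ∈ Ioo (-ε) ε, ContMDiffAt 𝓘(ℝ, E) 𝓘(ℝ, E) n (flow Z t) q := by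
    intro q hq t ht
    obtain ⟨h1, -, h3, -⟩ := (hΦ _ hq.2).2 t ht
    have hs : ContMDiffAt 𝓘(ℝ, E) 𝓘(ℝ, E) n φ.symm (Φ t (φ q)) :=
      (contMDiffOn_extChartAt_symm q₀).contMDiffAt
        ((isOpen_extChartAt_target q₀).mem_nhds h1.1)
    have hc : ContMDiffAt 𝓘(ℝ, E) 𝓘(ℝ, E) n φ q := contMDiffAt_extChartAt' (hsrc ▸ hq.1)
    refine (hs.comp q (h3.contMDiffAt.comp q hc)).congr_of_eventuallyEq ?_
    filter_upwards [hWo.mem_nhds hq] with p hp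
    exact hfl p hp t ht
  have hder : ∀ q ∈ W, ∀ t ∈ Ioo (-ε) ε, ∀ v : TangentSpace 𝓘(ℝ, E) q,
      chartDeriv q₀ (flow Z t q) (mfderiv 𝓘(ℝ, E) 𝓘(ℝ, E) (flow Z t) q v) =
        fderiv ℝ (Φ t) (φ q) (chartDeriv q₀ q v) := by
    intro q hq t ht v
    refine chartDeriv_mfderiv (hsrc ▸ hq.1) (hfs q hq t ht)
      ((hsm q hq t ht).mdifferentiableAt hn0)
      (((hΦ _ hq.2).2 t ht).2.2.1.differentiableAt hn0) ?_ v
    filter_upwards [hWo.mem_nhds hq] with p hp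
    exact hφf p hp t ht
  refine ⟨ε, hε, W, hWo, ⟨mem_extChartAt_source q₀, hxW'⟩, fun q hq => hsrc ▸ hq.1,
    fun q hq t ht => ?_⟩
  obtain ⟨h1, h2, -, h4⟩ := (hΦ _ hq.2).2 t ht
  have hIoo : Ioo (-ε) ε ∈ 𝓝 t := Ioo_mem_nhds ht.1 ht.2
  refine ⟨?_, ?_, hfs q hq t ht, hsm q hq t ht, ?_, fun v => ?_⟩
  · rw [hfl q hq t ht]
    exact hflows q hq t ht
  · rw [hfl q hq t ht]
    exact h1.2.2
  · change HasDerivAt (fun s => φ (flow Z s q)) (coordField q₀ Z (φ (flow Z t q))) t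
    rw [hφf q hq t ht, ← h1.2.1.eq_of_nhds]
    refine h2.congr_of_eventuallyEq ?_
    filter_upwards [hIoo] with s hs
    exact hφf q hq s hs
  · change HasDerivAt _ (fderiv ℝ (coordField q₀ Z) (φ (flow Z t q)) _) t
    rw [hφf q hq t ht, ← h1.2.1.fderiv_eq, hder q hq t ht v]
    refine (h4 _).congr_of_eventuallyEq ?_
    filter_upwards [hIoo] with s hs
    exact hder q hq s hs v

theorem flowsTo_zero (q : M) : FlowsTo Z 0 q q := by
  obtain ⟨ε, hε, W, -, hW, -, h⟩ := exists_local_flow_of_contMDiff hZ q one_ne_zero univ_mem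
  obtain ⟨γ, a, b, h0, -, hγ, h1, h2⟩ := (h q hW 0 ⟨neg_lt_zero.2 hε, hε⟩).1
  exact ⟨γ, a, b, h0, h0, hγ, h1, h1⟩

theorem flow_zero : flow Z 0 = id := funext fun q => (flowsTo_zero hZ q).flow_eq hZ

omit [FiniteDimensional ℝ E] in
theorem flow_add {s t : ℝ} {q : M} (hs : q ∈ flowDomain Z s) (ht : flow Z s q ∈ flowDomain Z t) :
    q ∈ flowDomain Z (s + t) ∧ flow Z (s + t) q = flow Z t (flow Z s q) := by
  have := (flowsTo_flow hZ hs).trans hZ (flowsTo_flow hZ ht)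
  exact ⟨⟨_, this⟩, this.flow_eq hZ⟩

omit [FiniteDimensional ℝ E] in
theorem flow_neg {t : ℝ} {q : M} (ht : q ∈ flowDomain Z t) :
    flow Z t q ∈ flowDomain Z (-t) ∧ flow Z (-t) (flow Z t q) = q := by
  have := (flowsTo_flow hZ ht).symm
  exact ⟨⟨_, this⟩, this.flow_eq hZ⟩

omit [FiniteDimensional ℝ E] in
/-- A property of times that is propagated forwards and backwards by the local flow near every
point holds on the whole time interval of an integral curve. -/
theorem flow_induction {q : M} {t : ℝ} (ht : q ∈ flowDomain Z t) {P : ℝ → Prop} (h0 : P 0)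
    (h : ∀ s, q ∈ flowDomain Z s → ∃ W ∈ 𝓝 (flow Z s q), ∃ ε > 0, ∀ r r', |r' - r| < ε →
      q ∈ flowDomain Z r → q ∈ flowDomain Z r' → flow Z r q ∈ W → P r → P r') : P t := by
  obtain ⟨p, γ, a, b, h0', ht', hγ, rfl, rfl⟩ := ht
  have hfl : ∀ s ∈ Ioo a b, FlowsTo Z s (γ 0) (γ s) := fun s hs => by
    simpa using flowsTo_of_isMIntegralCurveOn hγ h0' hs
  -- The relation `P s → P s'` is transitive and holds in both directions between nearby times,
  -- hence between any two points of the connected interval.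
  refine isPreconnected_Ioo.induction₂' (fun s s' => P s → P s') (fun s hs => ?_)
    (fun x y z _ _ _ h1 h2 h => h2 (h1 h)) h0' ht' h0
  obtain ⟨W, hW, ε, hε, H⟩ := h s ⟨_, hfl s hs⟩
  rw [(hfl s hs).flow_eq hZ] at hW
  filter_upwards [self_mem_nhdsWithin, hγ.continuousOn s hs hW,
    nhdsWithin_le_nhds (Metric.ball_mem_nhds s hε)] with s' hs' hs'W hball
  refine ⟨H s s' hball ⟨_, hfl s hs⟩ ⟨_, hfl s' hs'⟩ ?_,
    H s' s (by rw [abs_sub_comm]; exact hball) ⟨_, hfl s' hs'⟩ ⟨_, hfl s hs⟩ ?_⟩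
  · rw [(hfl s hs).flow_eq hZ]
    exact mem_of_mem_nhds hW
  · rw [(hfl s' hs').flow_eq hZ]
    exact hs'W

/-- For nearby times `r` and `r'`, the flow at time `r'` is the flow at time `r` followed by a local
flow. Openness of the domain is propagated with smoothness, since continuity at `r` is what brings
neighbouring points into the domain of the local flow. -/
theorem eventually_contMDiffAt_flow_nat {t : ℝ} {q : M} (ht : q ∈ flowDomain Z t) {n : ℕ}
    (hn : n ≠ 0) :
    ∀ᶠ p in 𝓝 q, p ∈ flowDomain Z t ∧ ContMDiffAt 𝓘(ℝ, E) 𝓘(ℝ, E) n (flow Z t) p := by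
  refine flow_induction hZ ht (P := fun t => ∀ᶠ p in 𝓝 q, p ∈ flowDomain Z t ∧
    ContMDiffAt 𝓘(ℝ, E) 𝓘(ℝ, E) n (flow Z t) p) ?_ (fun s hs => ?_)
  · refine Filter.Eventually.of_forall fun p => ⟨⟨p, flowsTo_zero hZ p⟩, ?_⟩
    rw [flow_zero hZ]
    exact contMDiffAt_id
  · obtain ⟨ε, hε, W, hWo, hW, -, h⟩ :=
      exists_local_flow_of_contMDiff hZ (flow Z s q) hn univ_mem
    refine ⟨W, hWo.mem_nhds hW, ε, hε, fun r r' hr hqr hqr' hrW hP => ?_⟩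
    have hc : ContinuousAt (flow Z r) q := hP.self_of_nhds.2.continuousAt
    have hrr : r' - r ∈ Ioo (-ε) ε := abs_lt.1 hr
    have hmain : ∀ᶠ p in 𝓝 q, p ∈ flowDomain Z r' ∧
        flow Z r' p = flow Z (r' - r) (flow Z r p) := by
      filter_upwards [hP, hc (hWo.mem_nhds hrW)] with p hp hpW
      have := flow_add hZ hp.1 ⟨_, (h _ hpW _ hrr).1⟩
      rwa [add_sub_cancel] at this
    filter_upwards [hP, hc (hWo.mem_nhds hrW), hmain.eventually_nhds] with p hp hpW hpm
    refine ⟨hpm.self_of_nhds.1, ?_⟩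
    exact ((h _ hpW _ hrr).2.2.2.1.comp p hp.2).congr_of_eventuallyEq (hpm.mono fun _ h => h.2)

theorem isOpen_flowDomain (t : ℝ) : IsOpen (flowDomain Z t) :=
  isOpen_iff_mem_nhds.2 fun _ hq =>
    (eventually_contMDiffAt_flow_nat hZ hq one_ne_zero).mono fun _ h => h.1

theorem contMDiffAt_flow {t : ℝ} {q : M} (ht : q ∈ flowDomain Z t) :
    ContMDiffAt 𝓘(ℝ, E) 𝓘(ℝ, E) ∞ (flow Z t) q := by
  rw [contMDiffAt_infty]
  intro n
  exact ((eventually_contMDiffAt_flow_nat hZ ht n.succ_ne_zero).self_of_nhds.2).of_le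
    (by exact_mod_cast n.le_succ)

omit [FiniteDimensional ℝ E] in
theorem image_flow (t : ℝ) : flow Z t '' flowDomain Z t = flowDomain Z (-t) := by
  ext p
  constructor
  · rintro ⟨q, hq, rfl⟩
    exact (flow_neg hZ hq).1
  · intro hp
    have := flow_neg hZ hp
    rw [neg_neg] at this
    exact ⟨_, this⟩

theorem isDiffeoOn_flow (t : ℝ) : IsDiffeoOn (E := E) (flow Z t) (flowDomain Z t) := by
  refine ⟨isOpen_flowDomain hZ t, ?_, fun q hq => (contMDiffAt_flow hZ hq).contMDiffWithinAt,
    flow Z (-t), ?_, fun q hq => (flow_neg hZ hq).2⟩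
  · rw [image_flow hZ]
    exact isOpen_flowDomain hZ _
  · rw [image_flow hZ]
    exact fun q hq => (contMDiffAt_flow hZ hq).contMDiffWithinAt

theorem mfderiv_flow_add {s t : ℝ} {q : M} (hs : q ∈ flowDomain Z s)
    (ht : flow Z s q ∈ flowDomain Z t) (v : TangentSpace 𝓘(ℝ, E) q) :
    mfderiv 𝓘(ℝ, E) 𝓘(ℝ, E) (flow Z (s + t)) q v =
      (mfderiv 𝓘(ℝ, E) 𝓘(ℝ, E) (flow Z t) (flow Z s q)
        (mfderiv 𝓘(ℝ, E) 𝓘(ℝ, E) (flow Z s) q v) : E) := by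
  have h1 := ((contMDiffAt_flow hZ ht).mdifferentiableAt (by simp)).hasMFDerivAt.comp q
    ((contMDiffAt_flow hZ hs).mdifferentiableAt (by simp)).hasMFDerivAt
  have h2 : flow Z (s + t) =ᶠ[𝓝 q] flow Z t ∘ flow Z s := by
    filter_upwards [(isOpen_flowDomain hZ s).mem_nhds hs,
      (contMDiffAt_flow hZ hs).continuousAt ((isOpen_flowDomain hZ t).mem_nhds ht)] with p hp hp'
    exact (flow_add hZ hp hp').2
  have h3 := (h1.congr_of_eventuallyEq h2).mfderiv
  exact congrArg (fun L : E →L[ℝ] E => L v) h3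

end FlowsTo

end SubSemiRiem
end

/-! ### Local frames and coframes of `H`; projections and bilinear forms in a chart. -/

noncomputable section

namespace SubSemiRiem

open Filter Topology

/-- A smooth family of operators that is injective at `x₀` has a smooth left inverse near `x₀`. -/
theorem exists_contDiffAt_leftInverse {E F V : Type*} [NormedAddCommGroup E] [NormedSpace ℝ E]
    [NormedAddCommGroup F] [NormedSpace ℝ F] [FiniteDimensional ℝ F]
    [NormedAddCommGroup V] [NormedSpace ℝ V] [FiniteDimensional ℝ V] {n : WithTop ℕ∞}
    {A : E → V →L[ℝ] F} {x₀ : E} (hA : ∀ᶠ x in 𝓝 x₀, ContDiffAt ℝ n A x)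
    (hinj : Function.Injective (A x₀)) :
    ∃ θ : E → F →L[ℝ] V, ∀ᶠ x in 𝓝 x₀, ContDiffAt ℝ n θ x ∧ ∀ c, θ x (A x c) = c := by
  have : CompleteSpace V := FiniteDimensional.complete ℝ V
  obtain ⟨T₀, hT₀⟩ := (A x₀ : V →ₗ[ℝ] F).exists_leftInverse_of_injective
    (LinearMap.ker_eq_bot.2 hinj)
  let T : F →L[ℝ] V := LinearMap.toContinuousLinearMap T₀
  let B : E → V →L[ℝ] V := fun x => T ∘L A x
  have hB : ∀ᶠ x in 𝓝 x₀, ContDiffAt ℝ n B x :=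
    hA.mono fun x hx => contDiffAt_const.clm_comp hx
  have hB0 : B x₀ = 1 := by
    ext c
    exact LinearMap.congr_fun hT₀ c
  have hunit : ∀ᶠ x in 𝓝 x₀, IsUnit (B x) := by
    refine hB.self_of_nhds.continuousAt.eventually (Units.isOpen.mem_nhds ?_)
    rw [hB0]
    exact isUnit_one
  -- With `T` a left inverse of `A x₀`, the operator `T ∘ A x` is invertible near `x₀`, and `(T ∘ A
  -- x)⁻¹ ∘ T` is a left inverse of `A x`.
  refine ⟨fun x => Ring.inverse (B x) ∘L T, ?_⟩
  filter_upwards [hB, hunit] with x hx hu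
  refine ⟨?_, fun c => ?_⟩
  · obtain ⟨e, he⟩ := hu
    have := contDiffAt_ringInverse ℝ (n := n) e
    rw [he] at this
    exact ContDiffAt.clm_comp (this.comp x hx) contDiffAt_const
  · exact congrArg (fun L : V →L[ℝ] V => L c) (Ring.inverse_mul_cancel _ hu)

variable {E : Type*} [NormedAddCommGroup E] [NormedSpace ℝ E]
  {M : Type*} [TopologicalSpace M] [ChartedSpace E M] [IsManifold 𝓘(ℝ, E) ∞ M]

theorem IsSmoothFieldOn.contMDiffAt {U : Set M} {X : (q : M) → TangentSpace 𝓘(ℝ, E) q}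
    (hX : IsSmoothFieldOn U X) {q : M} (hq : q ∈ U) :
    ContMDiffAt 𝓘(ℝ, E) 𝓘(ℝ, E).tangent ∞
      (fun q => (⟨q, X q⟩ : TangentBundle 𝓘(ℝ, E) M)) q :=
  hX.2.contMDiffAt (hX.1.mem_nhds hq)

theorem IsHorizontalOn.mono {H : (q : M) → Submodule ℝ (TangentSpace 𝓘(ℝ, E) q)} {U U' : Set M}
    {X : (q : M) → TangentSpace 𝓘(ℝ, E) q} (hX : IsHorizontalOn H U X) (hU' : IsOpen U')
    (h : U' ⊆ U) : IsHorizontalOn H U' X :=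
  ⟨⟨hU', hX.1.2.mono h⟩, fun q hq => hX.2 q (h hq)⟩

theorem isSmoothFieldOn_sum_smul {U : Set M} (hU : IsOpen U) {k : ℕ}
    {X : Fin k → (q : M) → TangentSpace 𝓘(ℝ, E) q} (hX : ∀ i, IsSmoothFieldOn U (X i))
    (c : Fin k → ℝ) : IsSmoothFieldOn U (fun q => ∑ i, c i • X i q) := by
  refine ⟨hU, fun q hq => ContMDiffAt.contMDiffWithinAt ?_⟩
  have hqs : q ∈ (chartAt E q).source := mem_chart_source E q
  rw [contMDiffAt_field_iff hqs le_rfl]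
  have h1 : ContMDiffAt 𝓘(ℝ, E) 𝓘(ℝ, E) ∞
      (fun p => ∑ i, c i • chartDeriv q p (X i p)) q :=
    ContMDiffAt.sum fun i _ =>
      (c i • ContinuousLinearMap.id ℝ E).contMDiff.contMDiffAt.comp q
        ((contMDiffAt_field_iff hqs le_rfl (X i)).1 ((hX i).contMDiffAt hq))
  refine h1.congr_of_eventuallyEq (Filter.Eventually.of_forall fun p => ?_)
  simp only [map_sum, map_smul]

section Metric

variable {S : SubSemiRiemannianStructure E M}

theorem metric_apply {q : M} {v w : TangentSpace 𝓘(ℝ, E) q} (hv : v ∈ S.H q) (hw : w ∈ S.H q) :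
    S.metric q v w = S.g q ⟨v, hv⟩ ⟨w, hw⟩ := by
  unfold SubSemiRiemannianStructure.metric evalOn
  rw [dif_pos ⟨hv, hw⟩]

theorem metric_sum_smul {q : M} {k : ℕ} {X : Fin k → TangentSpace 𝓘(ℝ, E) q}
    (hX : ∀ i, X i ∈ S.H q) (c d : Fin k → ℝ) :
    S.metric q (∑ i, c i • X i) (∑ j, d j • X j) =
      ∑ i, ∑ j, c i * (d j * S.metric q (X i) (X j)) := by
  have hmem : ∀ c : Fin k → ℝ, ∑ i, c i • X i ∈ S.H q := fun c =>
    Submodule.sum_mem _ fun i _ => Submodule.smul_mem _ _ (hX i)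
  have hsub : ∀ c : Fin k → ℝ, (⟨∑ i, c i • X i, hmem c⟩ : S.H q) = ∑ i, c i • ⟨X i, hX i⟩ := by
    intro c
    ext
    simp
  rw [metric_apply (hmem c) (hmem d), hsub, hsub]
  simp only [map_sum, map_smul, LinearMap.sum_apply, LinearMap.smul_apply, smul_eq_mul]
  simp only [metric_apply (hX _) (hX _), Finset.mul_sum]
  rw [Finset.sum_comm]
  exact Finset.sum_congr rfl fun i _ => Finset.sum_congr rfl fun j _ => by ring

end Metric

variable [FiniteDimensional ℝ E]

-- In `IsSmoothDistribution`, openness of `U` is carried by the frame fields. In rank zero there are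
-- none, and the whole manifold is taken instead.
omit [FiniteDimensional ℝ E] in
theorem exists_open_frame (S : SubSemiRiemannianStructure E M) (q₀ : M) :
    ∃ U : Set M, IsOpen U ∧ q₀ ∈ U ∧ ∃ X : Fin S.rank → (p : M) → TangentSpace 𝓘(ℝ, E) p,
      (∀ i, IsSmoothFieldOn U (X i)) ∧ ∀ p ∈ U, LinearIndependent ℝ (fun i => X i p) ∧
        Submodule.span ℝ (range fun i => X i p) = S.H p := by
  obtain ⟨U, hqU, X, hX, hXU⟩ := S.smooth_H q₀
  rcases isEmpty_or_nonempty (Fin S.rank) with h | ⟨⟨i⟩⟩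
  · refine ⟨univ, isOpen_univ, mem_univ _, X, fun i => h.elim i, fun p _ => ?_⟩
    obtain ⟨U', hpU', X', -, hXU'⟩ := S.smooth_H p
    rw [show (fun i => X i p) = fun i => X' i p from funext fun i => h.elim i]
    exact hXU' p hpU'
  · exact ⟨U, (hX i).1, hqU, X, hX, hXU⟩

/-- Near every point there are a horizontal frame and a smooth dual coframe. -/
theorem exists_local_coframe (S : SubSemiRiemannianStructure E M) (q₀ : M) :
    ∃ N : Set M, IsOpen N ∧ q₀ ∈ N ∧ N ⊆ (chartAt E q₀).source ∧
      ∃ X : Fin S.rank → (p : M) → TangentSpace 𝓘(ℝ, E) p,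
        (∀ i, IsHorizontalOn S.H N (X i)) ∧
        (∀ p ∈ N, ∀ v ∈ S.H p, ∃ c : Fin S.rank → ℝ, ∑ i, c i • X i p = v) ∧
        ∃ θ : E → E →L[ℝ] (Fin S.rank → ℝ), ∀ p ∈ N,
          ContDiffAt ℝ ∞ θ (extChartAt 𝓘(ℝ, E) q₀ p) ∧
          ∀ c : Fin S.rank → ℝ, θ (extChartAt 𝓘(ℝ, E) q₀ p)
            (chartDeriv q₀ p (∑ i, c i • X i p)) = c := by
  obtain ⟨U, hU, hqU, X, hX, hXU⟩ := exists_open_frame S q₀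
  let φ := extChartAt 𝓘(ℝ, E) q₀
  have hsrc : φ.source = (chartAt E q₀).source := extChartAt_source _ q₀
  let A : E → (Fin S.rank → ℝ) →L[ℝ] E := fun x =>
    ∑ i, (ContinuousLinearMap.proj i : (Fin S.rank → ℝ) →L[ℝ] ℝ).smulRight (coordField q₀ (X i) x)
  have hAp : ∀ p ∈ (chartAt E q₀).source, ∀ c : Fin S.rank → ℝ,
      A (φ p) c = chartDeriv q₀ p (∑ i, c i • X i p) := by
    intro p hp c
    simp only [A, _root_.sum_apply, ContinuousLinearMap.smulRight_apply, map_sum,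
      map_smul, ContinuousLinearMap.proj_apply]
    refine Finset.sum_congr rfl fun i _ => ?_
    rw [coordField_chart hp]
  have hAd : ∀ p ∈ U ∩ (chartAt E q₀).source, ContDiffAt ℝ ∞ A (φ p) := fun p hp =>
    ContDiffAt.sum fun i _ => contDiffAt_const.smulRight
      (contDiffAt_coordField hp.2 le_rfl ((hX i).contMDiffAt hp.1))
  have hq₀s : q₀ ∈ (chartAt E q₀).source := mem_chart_source E q₀
  have hnear : ∀ᶠ x in 𝓝 (φ q₀), ContDiffAt ℝ ∞ A x := by
    have h1 : ∀ᶠ x in 𝓝 (φ q₀), x ∈ φ.target :=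
      (isOpen_extChartAt_target q₀).mem_nhds (φ.map_source (hsrc ▸ hq₀s))
    have h2 : ∀ᶠ x in 𝓝 (φ q₀), φ.symm x ∈ U :=
      (continuousAt_extChartAt_symm q₀).eventually (by
        rw [extChartAt_to_inv]; exact hU.mem_nhds hqU)
    filter_upwards [h1, h2] with x hx1 hx2
    rw [← φ.right_inv hx1]
    exact hAd _ ⟨hx2, hsrc ▸ φ.map_target hx1⟩
  have hinj : Function.Injective (A (φ q₀)) := by
    refine (injective_iff_map_eq_zero _).2 fun c hc => ?_
    rw [hAp q₀ hq₀s] at hc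
    have h1 : ∑ i, c i • X i q₀ = 0 := by
      rw [← chartDerivInv_chartDeriv hq₀s (∑ i, c i • X i q₀), hc, map_zero]
    exact funext fun i => Fintype.linearIndependent_iff.1 (hXU q₀ hqU).1 c h1 i
  obtain ⟨θ, hθ⟩ := exists_contDiffAt_leftInverse hnear hinj
  have hθ' : ∀ᶠ p in 𝓝 q₀, ContDiffAt ℝ ∞ θ (φ p) ∧ ∀ c, θ (φ p) (A (φ p) c) = c :=
    (continuousAt_extChartAt q₀).eventually hθ
  obtain ⟨N, hN, hNo, hqN⟩ := eventually_nhds_iff.1 (hθ'.and ((hU.eventually_mem hqU).and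
    ((chartAt E q₀).open_source.eventually_mem hq₀s)))
  refine ⟨N, hNo, hqN, fun p hp => (hN p hp).2.2, X, fun i => ⟨⟨hNo, (hX i).2.mono fun p hp =>
    (hN p hp).2.1⟩, fun p hp => ?_⟩, fun p hp v hv => ?_, θ, fun p hp => ⟨(hN p hp).1.1,
    fun c => ?_⟩⟩
  · rw [← (hXU p (hN p hp).2.1).2]
    exact Submodule.subset_span ⟨i, rfl⟩
  · rw [← (hXU p (hN p hp).2.1).2] at hv
    exact (Submodule.mem_span_range_iff_exists_fun ℝ).1 hv
  · rw [← hAp p (hN p hp).2.2 c]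
    exact (hN p hp).1.2 c

theorem exists_horizontal_extension (S : SubSemiRiemannianStructure E M) {q : M}
    {v : TangentSpace 𝓘(ℝ, E) q} (hv : v ∈ S.H q) :
    ∃ (U : Set M) (X : (p : M) → TangentSpace 𝓘(ℝ, E) p), q ∈ U ∧ IsHorizontalOn S.H U X ∧
      X q = v := by
  obtain ⟨N, hN, hqN, -, X, hX, hspan, -⟩ := exists_local_coframe S q
  obtain ⟨c, hc⟩ := hspan q hqN v hv
  exact ⟨N, fun p => ∑ i, c i • X i p, hqN, ⟨isSmoothFieldOn_sum_smul hN (fun i => (hX i).1) c,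
    fun p hp => Submodule.sum_mem _ fun i _ => Submodule.smul_mem _ _ ((hX i).2 p hp)⟩, hc⟩

/-- In a chart, the distribution is the range of a smooth family of projections, and the metric
extends to a smooth family of bilinear forms. -/
theorem exists_local_model (S : SubSemiRiemannianStructure E M) (q₀ : M) :
    ∃ N : Set M, IsOpen N ∧ q₀ ∈ N ∧ N ⊆ (chartAt E q₀).source ∧
      (∃ P : E → E →L[ℝ] E, ∀ p ∈ N, ContDiffAt ℝ ∞ P (extChartAt 𝓘(ℝ, E) q₀ p) ∧
        (∀ v : TangentSpace 𝓘(ℝ, E) p, v ∈ S.H p ↔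
          P (extChartAt 𝓘(ℝ, E) q₀ p) (chartDeriv q₀ p v) = chartDeriv q₀ p v) ∧
        ∀ y, P (extChartAt 𝓘(ℝ, E) q₀ p) (P (extChartAt 𝓘(ℝ, E) q₀ p) y) =
          P (extChartAt 𝓘(ℝ, E) q₀ p) y) ∧
      ∃ G : E → E →L[ℝ] E →L[ℝ] ℝ, ∀ p ∈ N, ContDiffAt ℝ ∞ G (extChartAt 𝓘(ℝ, E) q₀ p) ∧
        ∀ v ∈ S.H p, ∀ w ∈ S.H p, G (extChartAt 𝓘(ℝ, E) q₀ p) (chartDeriv q₀ p v)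
          (chartDeriv q₀ p w) = S.metric p v w := by
  obtain ⟨N, hN, hqN, hNs, X, hX, hspan, θ, hθ⟩ := exists_local_coframe S q₀
  let φ := extChartAt 𝓘(ℝ, E) q₀
  have hsrc : φ.source = (chartAt E q₀).source := extChartAt_source _ q₀
  -- In terms of the frame `X` and the coframe `θ`, the witnesses are `P = ∑ θᵢ ⊗ Xᵢ` and `G = ∑
  -- g(Xᵢ, Xⱼ) θᵢ ⊗ θⱼ`.
  refine ⟨N, hN, hqN, hNs, ⟨fun x => ∑ i, ((ContinuousLinearMap.proj i :
    (Fin S.rank → ℝ) →L[ℝ] ℝ) ∘L θ x).smulRight (coordField q₀ (X i) x), fun p hp => ?_⟩,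
    fun x => ∑ i, ∑ j, (S.metric (φ.symm x) (X i (φ.symm x)) (X j (φ.symm x)) •
      ((ContinuousLinearMap.proj i : (Fin S.rank → ℝ) →L[ℝ] ℝ) ∘L θ x)).smulRight
        ((ContinuousLinearMap.proj j : (Fin S.rank → ℝ) →L[ℝ] ℝ) ∘L θ x), fun p hp => ?_⟩
  · have hPy : ∀ y, (∑ i, ((ContinuousLinearMap.proj i :
        (Fin S.rank → ℝ) →L[ℝ] ℝ) ∘L θ (φ p)).smulRight (coordField q₀ (X i) (φ p))) y =
        chartDeriv q₀ p (∑ i, θ (φ p) y i • X i p) := by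
      intro y
      simp only [_root_.sum_apply, ContinuousLinearMap.smulRight_apply, map_sum,
        map_smul]
      refine Finset.sum_congr rfl fun i _ => ?_
      rw [coordField_chart (hNs hp)]
      rfl
    refine ⟨ContDiffAt.sum fun i _ => (contDiffAt_const.clm_comp (hθ p hp).1).smulRight
      (contDiffAt_coordField (hNs hp) le_rfl ((hX i).1.contMDiffAt hp)), fun v => ⟨fun hv => ?_,
      fun hv => ?_⟩, fun y => ?_⟩
    · obtain ⟨c, rfl⟩ := hspan p hp v hv
      rw [hPy, (hθ p hp).2 c]
    · rw [hPy] at hv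
      have := congrArg (chartDerivInv q₀ p) hv
      rw [chartDerivInv_chartDeriv (hNs hp), chartDerivInv_chartDeriv (hNs hp)] at this
      rw [← this]
      exact Submodule.sum_mem _ fun i _ => Submodule.smul_mem _ _ ((hX i).2 p hp)
    · rw [hPy, hPy, (hθ p hp).2]
  · have hcoef : ∀ i, ContDiffAt ℝ ∞ (fun x => (ContinuousLinearMap.proj i :
        (Fin S.rank → ℝ) →L[ℝ] ℝ) ∘L θ x) (φ p) := fun i =>
      contDiffAt_const.clm_comp (hθ p hp).1
    have hpφ : φ.symm (φ p) = p := φ.left_inv (hsrc ▸ hNs hp)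
    have hg : ∀ i j, ContDiffAt ℝ ∞
        (fun x => S.metric (φ.symm x) (X i (φ.symm x)) (X j (φ.symm x))) (φ p) := by
      intro i j
      have h1 : ContMDiffAt 𝓘(ℝ, E) 𝓘(ℝ, ℝ) ∞ (fun q => S.metric q (X i q) (X j q)) p :=
        (S.smooth_g N _ _ (hX i) (hX j)).contMDiffAt (hN.mem_nhds hp)
      have h2 : ContMDiffAt 𝓘(ℝ, E) 𝓘(ℝ, E) ∞ φ.symm (φ p) :=
        (contMDiffOn_extChartAt_symm q₀).contMDiffAt
          ((isOpen_extChartAt_target q₀).mem_nhds (φ.map_source (hsrc ▸ hNs hp)))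
      rw [← hpφ] at h1
      exact (h1.comp _ h2).contDiffAt
    refine ⟨ContDiffAt.sum fun i _ => ContDiffAt.sum fun j _ => ((hg i j).smul (hcoef i)).smulRight
      (hcoef j), fun v hv w hw => ?_⟩
    · obtain ⟨c, rfl⟩ := hspan p hp v hv
      obtain ⟨d, rfl⟩ := hspan p hp w hw
      rw [metric_sum_smul (fun i => (hX i).2 p hp)]
      simp only [_root_.sum_apply, _root_.smul_apply,
        ContinuousLinearMap.smulRight_apply, ContinuousLinearMap.comp_apply,
        ContinuousLinearMap.proj_apply, (hθ p hp).2, smul_eq_mul]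
      refine Finset.sum_congr rfl fun i _ => Finset.sum_congr rfl fun j _ => ?_
      change S.metric (φ.symm (φ p)) (X i (φ.symm (φ p))) (X j (φ.symm (φ p))) * c i *
        d j = _
      rw [hpφ]
      ring

end SubSemiRiem
end

/-! ### Invariance of `H` under brackets with `Z` and under the flow. -/

noncomputable section

namespace SubSemiRiem

open Filter Topology

section Defect

variable {E : Type*} [NormedAddCommGroup E] [NormedSpace ℝ E]

/-- The failure of the linearized flow of `z` to preserve the ranges of the projections `P`. -/
def flowDefect (z : E → E) (P : E → E →L[ℝ] E) (x : E) : E →L[ℝ] E :=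
  fderiv ℝ z x - P x ∘L fderiv ℝ z x - fderiv ℝ P x (z x)

/-- Differentiating `X = P X` along `z` expresses `(1 - P) DX(z)` as `DP(z) X`. The derivative of
`X` thus drops out: the transversal part of the bracket depends only on the value of `X` at the
point. -/
theorem lieBracket_sub_projection {z X : E → E} {P : E → E →L[ℝ] E} {x : E}
    (hP : DifferentiableAt ℝ P x) (hX : DifferentiableAt ℝ X x)
    (h : X =ᶠ[𝓝 x] fun y => P y (X y)) :
    VectorField.lieBracket ℝ z X x - P x (VectorField.lieBracket ℝ z X x) =
      -flowDefect z P x (X x) := by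
  have h1 := hP.hasFDerivAt.clm_apply hX.hasFDerivAt
  have h2 := congrArg (fun L : E →L[ℝ] E => L (z x)) (h1.congr_of_eventuallyEq h).fderiv
  simp only [_root_.add_apply, ContinuousLinearMap.comp_apply,
    ContinuousLinearMap.flip_apply] at h2
  simp only [VectorField.lieBracket, flowDefect, map_sub, _root_.sub_apply,
    ContinuousLinearMap.comp_apply]
  nth_rewrite 1 [h2]
  abel

theorem hasDerivAt_sub_projection {z : E → E} {P : E → E →L[ℝ] E} {c y : ℝ → E} {t : ℝ}
    (hP : DifferentiableAt ℝ P (c t)) (hc : HasDerivAt c (z (c t)) t)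
    (hy : HasDerivAt y (fderiv ℝ z (c t) (y t)) t) :
    HasDerivAt (fun s => y s - P (c s) (y s)) (flowDefect z P (c t) (y t)) t := by
  have h1 : HasDerivAt (fun s => P (c s)) (fderiv ℝ P (c t) (z (c t))) t :=
    hP.hasFDerivAt.comp_hasDerivAt t hc
  refine (hy.sub (h1.clm_apply hy)).congr_deriv ?_
  simp only [flowDefect, _root_.sub_apply, ContinuousLinearMap.comp_apply]
  abel

theorem continuousAt_flowDefect {z : E → E} {P : E → E →L[ℝ] E} {x : E}
    (hz : ContDiffAt ℝ ∞ z x) (hP : ContDiffAt ℝ ∞ P x) : ContinuousAt (flowDefect z P) x := by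
  have h1 : ContinuousAt (fderiv ℝ z) x :=
    (hz.fderiv_right (m := 0) (by simp)).continuousAt
  have h2 : ContinuousAt (fderiv ℝ P) x :=
    (hP.fderiv_right (m := 0) (by simp)).continuousAt
  exact (h1.sub (hP.continuousAt.clm_comp h1)).sub (h2.clm_apply hz.continuousAt)

/-- A curve that starts in the range of the projections and is transported by the linearized flow
stays in the range, if the defect vanishes on the range. -/
theorem projection_eq_of_flowDefect_eq_zero {z : E → E} {P : E → E →L[ℝ] E} {c y : ℝ → E}
    {ε K : ℝ} (hP : ∀ t ∈ Ioo (-ε) ε, DifferentiableAt ℝ P (c t))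
    (hc : ∀ t ∈ Ioo (-ε) ε, HasDerivAt c (z (c t)) t)
    (hy : ∀ t ∈ Ioo (-ε) ε, HasDerivAt y (fderiv ℝ z (c t) (y t)) t)
    (hK : ∀ t ∈ Ioo (-ε) ε, ‖flowDefect z P (c t)‖ ≤ K)
    (h0 : ∀ t ∈ Ioo (-ε) ε, flowDefect z P (c t) (P (c t) (y t)) = 0)
    (hy0 : P (c 0) (y 0) = y 0) {t : ℝ} (ht : t ∈ Ioo (-ε) ε) : P (c t) (y t) = y t := by
  have h0ε : (0 : ℝ) ∈ Ioo (-ε) ε := by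
    have := ht.1.trans ht.2
    exact ⟨by linarith, by linarith⟩
  have hK0 : 0 ≤ K := (norm_nonneg _).trans (hK 0 h0ε)
  have := ODE_solution_unique_of_mem_Ioo (K := K.toNNReal)
    (v := fun t u => flowDefect z P (c t) u) (s := fun _ => univ)
    (f := fun t => y t - P (c t) (y t)) (g := fun _ => 0) (a := -ε) (b := ε) (t₀ := 0)
    (fun t ht => ((flowDefect z P (c t)).lipschitz.weaken (by
      rw [← NNReal.coe_le_coe, Real.coe_toNNReal K hK0]
      exact hK t ht)).lipschitzOnWith) h0ε
    -- Since the defect kills `P y`, its value at `y` is its value at `y - P y`; the equation for `y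
    -- - P y` is therefore linear and homogeneous, and the zero curve is its only solution.
    (fun t ht => ⟨(hasDerivAt_sub_projection (hP t ht) (hc t ht) (hy t ht)).congr_deriv (by
      rw [map_sub, h0 t ht, sub_zero]), mem_univ _⟩)
    (fun t ht => ⟨(hasDerivAt_const t (0 : E)).congr_deriv (by simp), mem_univ _⟩)
    (by simp [hy0]) ht
  exact (sub_eq_zero.1 this).symm

end Defect

variable {E : Type*} [NormedAddCommGroup E] [NormedSpace ℝ E] [FiniteDimensional ℝ E]
  {M : Type*} [TopologicalSpace M] [ChartedSpace E M] [IsManifold 𝓘(ℝ, E) ∞ M]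
  {S : SubSemiRiemannianStructure E M} {Z : (q : M) → TangentSpace 𝓘(ℝ, E) q}

section

variable (hZ : ContMDiff 𝓘(ℝ, E) 𝓘(ℝ, E).tangent ∞
  (fun q => (⟨q, Z q⟩ : TangentBundle 𝓘(ℝ, E) M)))
include hZ

theorem isSmoothFieldOn_mlieBracket {U : Set M} {X : (q : M) → TangentSpace 𝓘(ℝ, E) q}
    (hX : IsSmoothFieldOn U X) : IsSmoothFieldOn U (VectorField.mlieBracket 𝓘(ℝ, E) Z X) := by
  have : IsManifold 𝓘(ℝ, E) ((⊤ : ℕ∞) + 1) M := isManifold_of_le_infty E M _ le_rfl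
  have : IsManifold 𝓘(ℝ, E) (minSmoothness ℝ 2) M :=
    isManifold_of_le_infty E M _ two_le_minSmoothness_infty
  refine ⟨hX.1, fun q hq => ContMDiffAt.contMDiffWithinAt ?_⟩
  exact ContMDiffAt.mlieBracket_vectorField (m := ⊤) (n := ⊤) (hZ q) (hX.contMDiffAt hq) (by
    rw [minSmoothness_of_isRCLikeNormedField]
    exact le_rfl)

theorem mlieBracket_mem_iff {q₀ : M} {N : Set M} (hN : IsOpen N)
    (hNs : N ⊆ (chartAt E q₀).source) {P : E → E →L[ℝ] E}
    (hP : ∀ p ∈ N, ContDiffAt ℝ ∞ P (extChartAt 𝓘(ℝ, E) q₀ p) ∧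
        (∀ v : TangentSpace 𝓘(ℝ, E) p, v ∈ S.H p ↔
          P (extChartAt 𝓘(ℝ, E) q₀ p) (chartDeriv q₀ p v) = chartDeriv q₀ p v))
    {U : Set M} {X : (q : M) → TangentSpace 𝓘(ℝ, E) q} (hX : IsHorizontalOn S.H U X) {p : M}
    (hpU : p ∈ U) (hpN : p ∈ N) :
    VectorField.mlieBracket 𝓘(ℝ, E) Z X p ∈ S.H p ↔
      flowDefect (coordField q₀ Z) P (extChartAt 𝓘(ℝ, E) q₀ p) (chartDeriv q₀ p (X p)) = 0 := by
  let φ := extChartAt 𝓘(ℝ, E) q₀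
  have hsrc : φ.source = (chartAt E q₀).source := extChartAt_source _ q₀
  have hps := hNs hpN
  have hXd := contDiffAt_coordField hps le_rfl (hX.1.contMDiffAt hpU)
  have hφp : φ p ∈ φ.target := φ.map_source (hsrc ▸ hps)
  have hev : coordField q₀ X =ᶠ[𝓝 (φ p)] fun y => P y (coordField q₀ X y) := by
    have h1 : ∀ᶠ x in 𝓝 (φ p), φ.symm x ∈ N ∩ U :=
      (continuousAt_extChartAt_symm' (hsrc ▸ hps)).eventually (by
        rw [φ.left_inv (hsrc ▸ hps)]
        exact (hN.inter hX.1.1).mem_nhds ⟨hpN, hpU⟩)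
    filter_upwards [h1, (isOpen_extChartAt_target q₀).mem_nhds hφp] with x hx hxt
    have h2 := ((hP _ hx.1).2 (X (φ.symm x))).1 (hX.2 _ hx.2)
    change P (φ (φ.symm x)) _ = _ at h2
    rw [φ.right_inv hxt] at h2
    exact h2.symm
  have h3 := lieBracket_sub_projection (z := coordField q₀ Z)
    ((hP p hpN).1.differentiableAt (by simp)) (hXd.differentiableAt (by simp)) hev
  rw [← chartDeriv_mlieBracket hps (hZ p) (hX.1.contMDiffAt hpU), coordField_chart hps] at h3
  rw [(hP p hpN).2, eq_comm, ← sub_eq_zero, h3, neg_eq_zero]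

theorem flowDefect_eq_zero_of_adPreserves (hAd : AdPreserves S Z) {q₀ : M} {N : Set M}
    (hN : IsOpen N) (hNs : N ⊆ (chartAt E q₀).source) {P : E → E →L[ℝ] E}
    (hP : ∀ p ∈ N, ContDiffAt ℝ ∞ P (extChartAt 𝓘(ℝ, E) q₀ p) ∧
        (∀ v : TangentSpace 𝓘(ℝ, E) p, v ∈ S.H p ↔
          P (extChartAt 𝓘(ℝ, E) q₀ p) (chartDeriv q₀ p v) = chartDeriv q₀ p v))
    {p : M} (hpN : p ∈ N) {v : TangentSpace 𝓘(ℝ, E) p} (hv : v ∈ S.H p) :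
    flowDefect (coordField q₀ Z) P (extChartAt 𝓘(ℝ, E) q₀ p) (chartDeriv q₀ p v) = 0 := by
  obtain ⟨U, X, hpU, hX, rfl⟩ := exists_horizontal_extension S hv
  exact (mlieBracket_mem_iff hZ hN hNs hP hX hpU hpN).1 ((hAd U X hX).2 p hpU)

variable [T2Space M]

theorem exists_local_preserves (hAd : AdPreserves S Z) (q₀ : M) :
    ∃ ε > 0, ∃ W : Set M, IsOpen W ∧ q₀ ∈ W ∧ ∀ q ∈ W, ∀ t ∈ Ioo (-ε) ε,
      q ∈ flowDomain Z t ∧ ∀ v ∈ S.H q, mfderiv 𝓘(ℝ, E) 𝓘(ℝ, E) (flow Z t) q v ∈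
        S.H (flow Z t q) := by
  obtain ⟨N, hN, hqN, hNs, ⟨P, hP⟩, -⟩ := exists_local_model S q₀
  let φ := extChartAt 𝓘(ℝ, E) q₀
  let B := flowDefect (coordField q₀ Z) P
  have hB : ContinuousAt (fun p => B (φ p)) q₀ :=
    (continuousAt_flowDefect (contDiffAt_coordField (hNs hqN) le_rfl (hZ q₀))
      (hP q₀ hqN).1).comp (continuousAt_extChartAt q₀)
  -- The bound on the defect is the Lipschitz constant for uniqueness of the linear equation.
  have hV : {p | p ∈ N ∧ ‖B (φ p)‖ < ‖B (φ q₀)‖ + 1} ∈ 𝓝 q₀ :=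
    Filter.inter_mem (hN.mem_nhds hqN)
      (hB.norm.eventually (gt_mem_nhds (lt_add_one ‖B (φ q₀)‖)))
  obtain ⟨ε, hε, W, hWo, hqW, hWs, hW⟩ := exists_local_flow_of_contMDiff hZ q₀ one_ne_zero hV
  refine ⟨ε, hε, W, hWo, hqW, fun q hq t ht => ⟨⟨_, (hW q hq t ht).1⟩, fun v hv => ?_⟩⟩
  have h0ε : (0 : ℝ) ∈ Ioo (-ε) ε := ⟨neg_lt_zero.2 hε, hε⟩
  have hf0 : flow Z 0 q = q := by rw [flow_zero hZ]; rfl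
  have hqN' : q ∈ N := by
    have := (hW q hq 0 h0ε).2.1.1
    rwa [hf0] at this
  have hstart : chartDeriv q₀ (flow Z 0 q) (mfderiv 𝓘(ℝ, E) 𝓘(ℝ, E) (flow Z 0) q v) =
      chartDeriv q₀ q v := by
    rw [flow_zero hZ, mfderiv_id]
    rfl
  have key := projection_eq_of_flowDefect_eq_zero (z := coordField q₀ Z) (P := P)
    (c := fun s => φ (flow Z s q)) (ε := ε) (K := ‖B (φ q₀)‖ + 1)
    (y := fun s => chartDeriv q₀ (flow Z s q) (mfderiv 𝓘(ℝ, E) 𝓘(ℝ, E) (flow Z s) q v))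
    (fun s hs => (hP _ (hW q hq s hs).2.1.1).1.differentiableAt (by simp))
    (fun s hs => (hW q hq s hs).2.2.2.2.1) (fun s hs => (hW q hq s hs).2.2.2.2.2 v)
    (fun s hs => (hW q hq s hs).2.1.2.le) (fun s hs => ?_) ?_ ht
  · exact ((hP _ (hW q hq t ht).2.1.1).2.1 _).2 key
  · have hsN := (hW q hq s hs).2.1.1
    -- The transported vector is not yet known to be horizontal, but its image under the idempotent
    -- `P` is.
    have h1 := flowDefect_eq_zero_of_adPreserves hZ hAd hN hNs
      (fun p hp => ⟨(hP p hp).1, (hP p hp).2.1⟩) hsN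
      (v := chartDerivInv q₀ (flow Z s q) (P (φ (flow Z s q))
        (chartDeriv q₀ (flow Z s q) (mfderiv 𝓘(ℝ, E) 𝓘(ℝ, E) (flow Z s) q v)))) (by
        rw [(hP _ hsN).2.1, chartDeriv_chartDerivInv (hNs hsN), (hP _ hsN).2.2])
    rwa [chartDeriv_chartDerivInv (hNs hsN)] at h1
  · rw [hstart, hf0]
    exact ((hP q hqN').2.1 v).1 hv

theorem preservesOn_flow_of_adPreserves (hAd : AdPreserves S Z) (t : ℝ) :
    PreservesOn S (flow Z t) (flowDomain Z t) := by
  intro q hq v hv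
  refine flow_induction hZ hq (P := fun t => mfderiv 𝓘(ℝ, E) 𝓘(ℝ, E) (flow Z t) q v ∈
    S.H (flow Z t q)) ?_ (fun s hs => ?_)
  · rw [flow_zero hZ, mfderiv_id]
    exact hv
  · obtain ⟨ε, hε, W, hWo, hW, h⟩ := exists_local_preserves hZ hAd (flow Z s q)
    refine ⟨W, hWo.mem_nhds hW, ε, hε, fun r r' hr hqr hqr' hrW hrv => ?_⟩
    obtain ⟨hd, hp⟩ := h _ hrW (r' - r) (abs_lt.1 hr)
    have h1 := hp _ hrv
    have h2 := mfderiv_flow_add hZ hqr hd v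
    have h3 := (flow_add hZ hqr hd).2
    rw [add_sub_cancel] at h2 h3
    rw [h2, h3]
    exact h1

/-- Along the flow, the transversal part of the transported vector `X q` is identically zero; its
derivative at time zero is the defect at `X q`, which detects whether the bracket is horizontal. -/
theorem adPreserves_of_preservesOn_flow
    (h : ∀ t : ℝ, PreservesOn S (flow Z t) (flowDomain Z t)) : AdPreserves S Z := by
  refine fun U X hX => ⟨isSmoothFieldOn_mlieBracket hZ hX.1, fun q hq => ?_⟩
  obtain ⟨N, hN, hqN, hNs, ⟨P, hP⟩, -⟩ := exists_local_model S q
  rw [mlieBracket_mem_iff hZ hN hNs (fun p hp => ⟨(hP p hp).1, (hP p hp).2.1⟩) hX hq hqN]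
  obtain ⟨ε, hε, W, hWo, hqW, hWs, hW⟩ :=
    exists_local_flow_of_contMDiff hZ q one_ne_zero (hN.mem_nhds hqN)
  have h0ε : (0 : ℝ) ∈ Ioo (-ε) ε := ⟨neg_lt_zero.2 hε, hε⟩
  have hf0 : flow Z 0 q = q := by rw [flow_zero hZ]; rfl
  have h0 := hW q hqW 0 h0ε
  have hder := hasDerivAt_sub_projection
    (((hP _ h0.2.1).1.differentiableAt (by simp))) h0.2.2.2.2.1 (h0.2.2.2.2.2 (X q))
  have hzero : HasDerivAt (fun s => chartDeriv q (flow Z s q)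
      (mfderiv 𝓘(ℝ, E) 𝓘(ℝ, E) (flow Z s) q (X q)) -
      P (extChartAt 𝓘(ℝ, E) q (flow Z s q)) (chartDeriv q (flow Z s q)
      (mfderiv 𝓘(ℝ, E) 𝓘(ℝ, E) (flow Z s) q (X q)))) 0 0 := by
    refine (hasDerivAt_const (0 : ℝ) (0 : E)).congr_of_eventuallyEq ?_
    filter_upwards [Ioo_mem_nhds h0ε.1 h0ε.2] with s hs
    have hs' := hW q hqW s hs
    rw [sub_eq_zero, eq_comm, ← (hP _ hs'.2.1).2.1]
    exact h s q ⟨_, hs'.1⟩ _ (hX.2 q hq)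
  have := hder.unique hzero
  rw [flow_zero hZ, mfderiv_id] at this
  exact this

theorem adPreserves_iff :
    AdPreserves S Z ↔ ∀ t : ℝ, PreservesOn S (flow Z t) (flowDomain Z t) :=
  ⟨preservesOn_flow_of_adPreserves hZ, adPreserves_of_preservesOn_flow hZ⟩

end

end SubSemiRiem
end

/-! ### The derivative of the pulled back metric at time zero. -/

noncomputable section

namespace SubSemiRiem

open Filter Topology

section Bilinear

variable {E : Type*} [NormedAddCommGroup E] [NormedSpace ℝ E]

/-- The derivatives of `X` and `Y` along `z` cancel against those in the brackets. What remains is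
the expression in `hasDerivAt_bilin_transport`. -/
theorem fderiv_bilin_sub_lieBracket {z X Y : E → E} {G : E → E →L[ℝ] E →L[ℝ] ℝ} {x : E}
    (hG : DifferentiableAt ℝ G x) (hX : DifferentiableAt ℝ X x) (hY : DifferentiableAt ℝ Y x) :
    fderiv ℝ (fun y => G y (X y) (Y y)) x (z x) -
      G x (VectorField.lieBracket ℝ z X x) (Y x) - G x (X x) (VectorField.lieBracket ℝ z Y x) =
    fderiv ℝ G x (z x) (X x) (Y x) + G x (fderiv ℝ z x (X x)) (Y x) +
      G x (X x) (fderiv ℝ z x (Y x)) := by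
  have h1 := (hG.hasFDerivAt.clm_apply hX.hasFDerivAt).clm_apply hY.hasFDerivAt
  rw [h1.fderiv]
  simp only [VectorField.lieBracket, map_sub, _root_.sub_apply, _root_.add_apply,
    ContinuousLinearMap.comp_apply, ContinuousLinearMap.flip_apply]
  ring

theorem hasDerivAt_bilin_transport {z : E → E} {G : E → E →L[ℝ] E →L[ℝ] ℝ} {c y w : ℝ → E} {t : ℝ}
    (hG : DifferentiableAt ℝ G (c t)) (hc : HasDerivAt c (z (c t)) t)
    (hy : HasDerivAt y (fderiv ℝ z (c t) (y t)) t)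
    (hw : HasDerivAt w (fderiv ℝ z (c t) (w t)) t) :
    HasDerivAt (fun s => G (c s) (y s) (w s))
      (fderiv ℝ G (c t) (z (c t)) (y t) (w t) + G (c t) (fderiv ℝ z (c t) (y t)) (w t) +
        G (c t) (y t) (fderiv ℝ z (c t) (w t))) t := by
  have h1 : HasDerivAt (fun s => G (c s)) (fderiv ℝ G (c t) (z (c t))) t :=
    HasFDerivAt.comp_hasDerivAt (l := G) (l' := fderiv ℝ G (c t)) t hG.hasFDerivAt hc
  exact ((h1.clm_apply hy).clm_apply hw).congr_deriv (by simp [_root_.add_apply])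

end Bilinear

variable {E : Type*} [NormedAddCommGroup E] [NormedSpace ℝ E] [FiniteDimensional ℝ E]
  {M : Type*} [TopologicalSpace M] [ChartedSpace E M] [IsManifold 𝓘(ℝ, E) ∞ M]
  {S : SubSemiRiemannianStructure E M} {Z : (q : M) → TangentSpace 𝓘(ℝ, E) q}

omit [FiniteDimensional ℝ E] in
theorem metric_comp_chart_eventuallyEq {q₀ : M} {N : Set M} (hN : IsOpen N)
    (hNs : N ⊆ (chartAt E q₀).source) {G : E → E →L[ℝ] E →L[ℝ] ℝ}
    (hG : ∀ p ∈ N, ∀ v ∈ S.H p, ∀ w ∈ S.H p,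
      G (extChartAt 𝓘(ℝ, E) q₀ p) (chartDeriv q₀ p v) (chartDeriv q₀ p w) = S.metric p v w)
    {U : Set M} {X Y : (q : M) → TangentSpace 𝓘(ℝ, E) q} (hX : IsHorizontalOn S.H U X)
    (hY : IsHorizontalOn S.H U Y) {p : M} (hpU : p ∈ U) (hpN : p ∈ N) :
    (fun p => S.metric p (X p) (Y p)) =ᶠ[𝓝 p]
      (fun x => G x (coordField q₀ X x) (coordField q₀ Y x)) ∘ extChartAt 𝓘(ℝ, E) q₀ := by
  filter_upwards [(hN.inter hX.1.1).mem_nhds ⟨hpN, hpU⟩] with r hr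
  rw [← hG r hr.1 _ (hX.2 r hr.2) _ (hY.2 r hr.2)]
  simp only [Function.comp_apply, coordField_chart (hNs hr.1)]

omit [FiniteDimensional ℝ E] in
theorem derivMetricAlong_eq {q₀ : M} {N : Set M} (hN : IsOpen N)
    (hNs : N ⊆ (chartAt E q₀).source) {G : E → E →L[ℝ] E →L[ℝ] ℝ}
    (hGs : ∀ p ∈ N, ContDiffAt ℝ ∞ G (extChartAt 𝓘(ℝ, E) q₀ p))
    (hG : ∀ p ∈ N, ∀ v ∈ S.H p, ∀ w ∈ S.H p,
      G (extChartAt 𝓘(ℝ, E) q₀ p) (chartDeriv q₀ p v) (chartDeriv q₀ p w) = S.metric p v w)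
    {U : Set M} {X Y : (q : M) → TangentSpace 𝓘(ℝ, E) q} (hX : IsHorizontalOn S.H U X)
    (hY : IsHorizontalOn S.H U Y) {p : M} (hpU : p ∈ U) (hpN : p ∈ N) :
    derivMetricAlong S Z X Y p =
      fderiv ℝ (fun x => G x (coordField q₀ X x) (coordField q₀ Y x)) (extChartAt 𝓘(ℝ, E) q₀ p)
        (coordField q₀ Z (extChartAt 𝓘(ℝ, E) q₀ p)) := by
  have hXd := contDiffAt_coordField (hNs hpN) le_rfl (hX.1.contMDiffAt hpU)
  have hYd := contDiffAt_coordField (hNs hpN) le_rfl (hY.1.contMDiffAt hpU)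
  have hF := ((((hGs p hpN).clm_apply hXd).clm_apply hYd).differentiableAt
    (by simp)).hasFDerivAt.hasMFDerivAt
  have h1 := (hF.comp p (hasMFDerivAt_chart (hNs hpN))).congr_of_eventuallyEq
    (metric_comp_chart_eventuallyEq hN hNs hG hX hY hpU hpN)
  rw [derivMetricAlong, h1.mfderiv]
  exact congrArg (fderiv ℝ (fun x => G x (coordField q₀ X x) (coordField q₀ Y x))
    (extChartAt 𝓘(ℝ, E) q₀ p)) (coordField_chart (hNs hpN) Z).symm

theorem contMDiffAt_derivMetricAlong
    (hZ : ContMDiff 𝓘(ℝ, E) 𝓘(ℝ, E).tangent ∞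
      (fun q => (⟨q, Z q⟩ : TangentBundle 𝓘(ℝ, E) M))) {U : Set M}
    {X Y : (q : M) → TangentSpace 𝓘(ℝ, E) q} (hX : IsHorizontalOn S.H U X)
    (hY : IsHorizontalOn S.H U Y) {p : M} (hp : p ∈ U) :
    ContMDiffAt 𝓘(ℝ, E) 𝓘(ℝ, ℝ) ∞ (derivMetricAlong S Z X Y) p := by
  obtain ⟨N, hN, hpN, hNs, -, G, hG⟩ := exists_local_model S p
  have hXd := contDiffAt_coordField (hNs hpN) le_rfl (hX.1.contMDiffAt hp)
  have hYd := contDiffAt_coordField (hNs hpN) le_rfl (hY.1.contMDiffAt hp)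
  have hZd := contDiffAt_coordField (hNs hpN) le_rfl (hZ p)
  have hF := (((hG p hpN).1.clm_apply hXd).clm_apply hYd)
  have h1 := (hF.fderiv_right (m := ∞) (by simp)).clm_apply hZd
  refine (h1.contMDiffAt.comp p (contMDiffAt_extChartAt (n := ∞))).congr_of_eventuallyEq ?_
  filter_upwards [(hN.inter hX.1.1).mem_nhds ⟨hpN, hp⟩] with r hr
  exact derivMetricAlong_eq hN hNs (fun p hp => (hG p hp).1) (fun p hp => (hG p hp).2) hX hY
    hr.2 hr.1

variable [T2Space M] (hZ : ContMDiff 𝓘(ℝ, E) 𝓘(ℝ, E).tangent ∞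
  (fun q => (⟨q, Z q⟩ : TangentBundle 𝓘(ℝ, E) M)))
include hZ

/-- The extension `G` represents the metric only on `H`. Invariance of `H` is used twice: for the
transported vectors, and for the brackets. -/
theorem hasDerivAt_pullbackMetric (hAd : AdPreserves S Z) {U : Set M}
    {X Y : (q : M) → TangentSpace 𝓘(ℝ, E) q} (hX : IsHorizontalOn S.H U X)
    (hY : IsHorizontalOn S.H U Y) {q : M} (hq : q ∈ U) :
    HasDerivAt (fun t => pullbackMetric S (flow Z t) q (X q) (Y q))
      (derivMetricAlong S Z X Y q - S.metric q (VectorField.mlieBracket 𝓘(ℝ, E) Z X q) (Y q) -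
        S.metric q (X q) (VectorField.mlieBracket 𝓘(ℝ, E) Z Y q)) 0 := by
  obtain ⟨N, hN, hqN, hNs, -, G, hG⟩ := exists_local_model S q
  obtain ⟨ε, hε, W, hWo, hqW, hWs, hW⟩ :=
    exists_local_flow_of_contMDiff hZ q one_ne_zero (hN.mem_nhds hqN)
  have h0ε : (0 : ℝ) ∈ Ioo (-ε) ε := ⟨neg_lt_zero.2 hε, hε⟩
  have h0 := hW q hqW 0 h0ε
  have hXd := contDiffAt_coordField (hNs hqN) le_rfl (hX.1.contMDiffAt hq)
  have hYd := contDiffAt_coordField (hNs hqN) le_rfl (hY.1.contMDiffAt hq)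
  have hder := hasDerivAt_bilin_transport (c := fun s => extChartAt 𝓘(ℝ, E) q (flow Z s q))
    ((hG _ h0.2.1).1.differentiableAt (by simp)) h0.2.2.2.2.1
    (h0.2.2.2.2.2 (X q)) (h0.2.2.2.2.2 (Y q))
  have hev : (fun t => pullbackMetric S (flow Z t) q (X q) (Y q)) =ᶠ[𝓝 0]
      fun s => G (extChartAt 𝓘(ℝ, E) q (flow Z s q))
        (chartDeriv q (flow Z s q) (mfderiv 𝓘(ℝ, E) 𝓘(ℝ, E) (flow Z s) q (X q)))
        (chartDeriv q (flow Z s q) (mfderiv 𝓘(ℝ, E) 𝓘(ℝ, E) (flow Z s) q (Y q))) := by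
    filter_upwards [Ioo_mem_nhds h0ε.1 h0ε.2] with s hs
    have hs' := hW q hqW s hs
    have hpres := preservesOn_flow_of_adPreserves hZ hAd s q ⟨_, hs'.1⟩
    exact ((hG _ hs'.2.1).2 _ (hpres _ (hX.2 q hq)) _ (hpres _ (hY.2 q hq))).symm
  refine (hder.congr_of_eventuallyEq hev).congr_deriv ?_
  rw [flow_zero hZ, mfderiv_id]
  have h1 := fderiv_bilin_sub_lieBracket (z := coordField q Z)
    ((hG q hqN).1.differentiableAt (by simp)) (hXd.differentiableAt (by simp))
    (hYd.differentiableAt (by simp))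
  rw [← chartDeriv_mlieBracket (hNs hqN) (hZ q) (hX.1.contMDiffAt hq),
    ← chartDeriv_mlieBracket (hNs hqN) (hZ q) (hY.1.contMDiffAt hq),
    coordField_chart (hNs hqN) X, coordField_chart (hNs hqN) Y,
    ← derivMetricAlong_eq hN hNs (fun p hp => (hG p hp).1) (fun p hp => (hG p hp).2) hX hY hq hqN,
    (hG q hqN).2 _ ((hAd U X hX).2 q hq) _ (hY.2 q hq),
    (hG q hqN).2 _ (hX.2 q hq) _ ((hAd U Y hY).2 q hq)] at h1
  exact h1.symm

end SubSemiRiem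
end

/-! ### Conformal factors: integration along the flow and smoothness. -/

noncomputable section

namespace SubSemiRiem

open Filter Topology

variable {E : Type*} [NormedAddCommGroup E] [NormedSpace ℝ E] [FiniteDimensional ℝ E]
  {M : Type*} [TopologicalSpace M] [ChartedSpace E M] [IsManifold 𝓘(ℝ, E) ∞ M]
  {S : SubSemiRiemannianStructure E M} {Z : (q : M) → TangentSpace 𝓘(ℝ, E) q}

omit [FiniteDimensional ℝ E] in
theorem metric_eq_zero_of_rank_eq_zero (h : S.rank = 0) {q : M} {v w : TangentSpace 𝓘(ℝ, E) q}
    (hv : v ∈ S.H q) (hw : w ∈ S.H q) : S.metric q v w = 0 := by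
  obtain ⟨U, hqU, X, -, hX⟩ := S.smooth_H q
  have hbot : S.H q = ⊥ := by
    have : IsEmpty (Fin S.rank) := by rw [h]; infer_instance
    rw [← (hX q hqU).2, range_eq_empty, Submodule.span_empty]
  have hv0 : v = 0 := by rwa [hbot, Submodule.mem_bot] at hv
  subst hv0
  rw [metric_apply hv hw]
  have : (⟨0, hv⟩ : S.H q) = 0 := rfl
  rw [this, map_zero, LinearMap.zero_apply]

-- Two vectors are needed: `g` may be indefinite, so a nonzero vector can be null, but nondegeneracy
-- gives it a partner.
omit [FiniteDimensional ℝ E] in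
theorem exists_metric_ne_zero (h : S.rank ≠ 0) (q : M) :
    ∃ v ∈ S.H q, ∃ w ∈ S.H q, S.metric q v w ≠ 0 := by
  obtain ⟨U, hqU, X, -, hX⟩ := S.smooth_H q
  obtain ⟨hli, hspan⟩ := hX q hqU
  have hmem : X ⟨0, Nat.pos_of_ne_zero h⟩ q ∈ S.H q := by
    rw [← hspan]
    exact Submodule.subset_span ⟨_, rfl⟩
  by_contra! hcon
  have hz := (S.nondegenerate_g q).1 ⟨_, hmem⟩ fun w => by
    rw [← metric_apply hmem w.2]
    exact hcon _ hmem _ w.2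
  exact hli.ne_zero ⟨0, Nat.pos_of_ne_zero h⟩ (congrArg Subtype.val hz)

theorem exists_horizontal_extension₂ (S : SubSemiRiemannianStructure E M) {q : M}
    {v w : TangentSpace 𝓘(ℝ, E) q} (hv : v ∈ S.H q) (hw : w ∈ S.H q) :
    ∃ (U : Set M) (X Y : (p : M) → TangentSpace 𝓘(ℝ, E) p), q ∈ U ∧ IsHorizontalOn S.H U X ∧
      IsHorizontalOn S.H U Y ∧ X q = v ∧ Y q = w := by
  obtain ⟨U, X, hqU, hX, hXq⟩ := exists_horizontal_extension S hv
  obtain ⟨V, Y, hqV, hY, hYq⟩ := exists_horizontal_extension S hw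
  exact ⟨U ∩ V, X, Y, ⟨hqU, hqV⟩, hX.mono (hX.1.1.inter hY.1.1) inter_subset_left,
    hY.mono (hX.1.1.inter hY.1.1) inter_subset_right, hXq, hYq⟩

omit [FiniteDimensional ℝ E] in
theorem contMDiffAt_metric {U : Set M} {X Y : (q : M) → TangentSpace 𝓘(ℝ, E) q}
    (hX : IsHorizontalOn S.H U X) (hY : IsHorizontalOn S.H U Y) {q : M} (hq : q ∈ U) :
    ContMDiffAt 𝓘(ℝ, E) 𝓘(ℝ, ℝ) ∞ (fun p => S.metric p (X p) (Y p)) q :=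
  (S.smooth_g U X Y hX hY).contMDiffAt (hX.1.1.mem_nhds hq)

-- In charts at `q` and `f q` the pushed vector is the derivative of the coordinate expression of
-- `f` applied to the coordinates of `X`.
omit [FiniteDimensional ℝ E] in
theorem contMDiffAt_chartDeriv_mfderiv {f : M → M} {q : M}
    (hf : ∀ᶠ p in 𝓝 q, ContMDiffAt 𝓘(ℝ, E) 𝓘(ℝ, E) ∞ f p)
    {X : (q : M) → TangentSpace 𝓘(ℝ, E) q}
    (hX : ContMDiffAt 𝓘(ℝ, E) 𝓘(ℝ, E).tangent ∞
      (fun q => (⟨q, X q⟩ : TangentBundle 𝓘(ℝ, E) M)) q) :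
    ContMDiffAt 𝓘(ℝ, E) 𝓘(ℝ, E) ∞
      (fun p => chartDeriv (f q) (f p) (mfderiv 𝓘(ℝ, E) 𝓘(ℝ, E) f p (X p))) q := by
  let φ := extChartAt 𝓘(ℝ, E) q
  let χ := extChartAt 𝓘(ℝ, E) (f q)
  have hqs : q ∈ (chartAt E q).source := mem_chart_source E q
  have hF : ∀ᶠ p in 𝓝 q, ContDiffAt ℝ ∞ (χ ∘ f ∘ φ.symm) (φ p) ∧ f p ∈ (chartAt E (f q)).source ∧
      p ∈ (chartAt E q).source ∧ ContMDiffAt 𝓘(ℝ, E) 𝓘(ℝ, E) ∞ f p := by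
    filter_upwards [hf, (chartAt E q).open_source.mem_nhds hqs,
      hf.self_of_nhds.continuousAt ((chartAt E (f q)).open_source.mem_nhds
        (mem_chart_source E (f q)))] with p hp hps hfps
    refine ⟨?_, hfps, hps, hp⟩
    have hps' : p ∈ φ.source := by rwa [extChartAt_source]
    have h1 : ContMDiffAt 𝓘(ℝ, E) 𝓘(ℝ, E) ∞ φ.symm (φ p) :=
      (contMDiffOn_extChartAt_symm q).contMDiffAt
        ((isOpen_extChartAt_target q).mem_nhds (φ.map_source hps'))
    have h2 : φ.symm (φ p) = p := φ.left_inv hps'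
    have h3 : ContMDiffAt 𝓘(ℝ, E) 𝓘(ℝ, E) ∞ χ (f p) :=
      contMDiffAt_extChartAt' hfps
    refine contMDiffAt_iff_contDiffAt.1 (ContMDiffAt.comp (I' := 𝓘(ℝ, E)) (φ p) (g := χ)
      (f := f ∘ φ.symm) ?_ ?_)
    · rw [Function.comp_apply, h2]
      exact h3
    · refine ContMDiffAt.comp (I' := 𝓘(ℝ, E)) (φ p) (g := f) (f := φ.symm) ?_ h1
      rwa [h2]
  have hX' := (contMDiffAt_field_iff hqs le_rfl X).1 hX
  have h4 : ContMDiffAt 𝓘(ℝ, E) 𝓘(ℝ, E) ∞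
      (fun p => fderiv ℝ (χ ∘ f ∘ φ.symm) (φ p) (chartDeriv q p (X p))) q :=
    ContMDiffAt.clm_apply ((hF.self_of_nhds.1.fderiv_right (m := ∞) (by simp)).contMDiffAt.comp q
      (contMDiffAt_extChartAt (I := 𝓘(ℝ, E)) (n := ∞))) hX'
  refine h4.congr_of_eventuallyEq ?_
  filter_upwards [hF] with p hp
  refine chartDeriv_mfderiv hp.2.2.1 hp.2.1 (hp.2.2.2.mdifferentiableAt (by simp))
    (hp.1.differentiableAt (by simp)) ?_ _
  filter_upwards [(chartAt E q).open_source.mem_nhds hp.2.2.1] with r hr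
  have : φ.symm (φ r) = r := φ.left_inv (by rwa [extChartAt_source])
  simp only [Function.comp_apply]
  rw [this]

theorem contMDiffAt_pullbackMetric {f : M → M} {U V : Set M} (hV : IsOpen V)
    (hf : ∀ p ∈ V, ContMDiffAt 𝓘(ℝ, E) 𝓘(ℝ, E) ∞ f p) (hpres : PreservesOn S f V)
    {X Y : (q : M) → TangentSpace 𝓘(ℝ, E) q}
    (hX : IsHorizontalOn S.H U X) (hY : IsHorizontalOn S.H U Y) {q : M} (hq : q ∈ U)
    (hqV : q ∈ V) :
    ContMDiffAt 𝓘(ℝ, E) 𝓘(ℝ, ℝ) ∞ (fun p => pullbackMetric S f p (X p) (Y p)) q := by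
  obtain ⟨N, hN, hqN, hNs, -, G, hG⟩ := exists_local_model S (f q)
  have hfe : ∀ᶠ p in 𝓝 q, ContMDiffAt 𝓘(ℝ, E) 𝓘(ℝ, E) ∞ f p :=
    Filter.Eventually.mono (hV.mem_nhds hqV) hf
  have h1 := contMDiffAt_chartDeriv_mfderiv hfe (hX.1.contMDiffAt hq)
  have h2 := contMDiffAt_chartDeriv_mfderiv hfe (hY.1.contMDiffAt hq)
  have h3 : ContMDiffAt 𝓘(ℝ, E) 𝓘(ℝ, E →L[ℝ] E →L[ℝ] ℝ) ∞
      (fun p => G (extChartAt 𝓘(ℝ, E) (f q) (f p))) q :=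
    (hG _ hqN).1.contMDiffAt.comp q ((contMDiffAt_extChartAt (n := ∞)).comp q (hf q hqV))
  refine ((h3.clm_apply h1).clm_apply h2).congr_of_eventuallyEq ?_
  filter_upwards [(hV.inter hX.1.1).mem_nhds ⟨hqV, hq⟩,
    (hf q hqV).continuousAt (hN.mem_nhds hqN)] with p hp hpN
  exact ((hG _ hpN).2 _ (hpres p hp.1 _ (hX.2 p hp.2)) _ (hpres p hp.1 _ (hY.2 p hp.2))).symm

section FlowMetric

variable [T2Space M] (hZ : ContMDiff 𝓘(ℝ, E) 𝓘(ℝ, E).tangent ∞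
  (fun q => (⟨q, Z q⟩ : TangentBundle 𝓘(ℝ, E) M)))
include hZ

theorem differentiableAt_pullbackMetric_flow (hAd : AdPreserves S Z) {q : M}
    {v w : TangentSpace 𝓘(ℝ, E) q} (hv : v ∈ S.H q) (hw : w ∈ S.H q) :
    DifferentiableAt ℝ (fun t => pullbackMetric S (flow Z t) q v w) 0 := by
  obtain ⟨U, X, Y, hqU, hX, hY, rfl, rfl⟩ := exists_horizontal_extension₂ S hv hw
  exact (hasDerivAt_pullbackMetric hZ hAd hX hY hqU).differentiableAt

theorem restrictedLieDeriv_eq (hAd : AdPreserves S Z) {U : Set M}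
    {X Y : (q : M) → TangentSpace 𝓘(ℝ, E) q} (hX : IsHorizontalOn S.H U X)
    (hY : IsHorizontalOn S.H U Y) {q : M} (hq : q ∈ U) :
    restrictedLieDeriv S Z q (X q) (Y q) =
      derivMetricAlong S Z X Y q - S.metric q (VectorField.mlieBracket 𝓘(ℝ, E) Z X q) (Y q) -
        S.metric q (X q) (VectorField.mlieBracket 𝓘(ℝ, E) Z Y q) :=
  (hasDerivAt_pullbackMetric hZ hAd hX hY hq).deriv

theorem restrictedLieDeriv_eq_mul_iff (hAd : AdPreserves S Z) (μ : M → ℝ) :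
    (∀ q : M, ∀ v ∈ S.H q, ∀ w ∈ S.H q,
      restrictedLieDeriv S Z q v w = μ q * S.metric q v w) ↔
    ∀ (U : Set M) (X Y : (q : M) → TangentSpace 𝓘(ℝ, E) q),
      IsHorizontalOn S.H U X → IsHorizontalOn S.H U Y → ∀ q ∈ U,
        derivMetricAlong S Z X Y q =
          S.metric q (VectorField.mlieBracket 𝓘(ℝ, E) Z X q) (Y q) +
          S.metric q (X q) (VectorField.mlieBracket 𝓘(ℝ, E) Z Y q) +
          μ q * S.metric q (X q) (Y q) := by
  refine ⟨fun h U X Y hX hY q hq => ?_, fun h q v hv w hw => ?_⟩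
  · rw [← h q _ (hX.2 q hq) _ (hY.2 q hq), restrictedLieDeriv_eq hZ hAd hX hY hq]
    ring
  · obtain ⟨U, X, Y, hqU, hX, hY, rfl, rfl⟩ := exists_horizontal_extension₂ S hv hw
    rw [restrictedLieDeriv_eq hZ hAd hX hY hqU, h U X Y hX hY q hqU]
    ring

theorem pullbackMetric_flow_add {s t : ℝ} {q : M} (hs : q ∈ flowDomain Z s)
    (ht : flow Z s q ∈ flowDomain Z t) (v w : TangentSpace 𝓘(ℝ, E) q) :
    pullbackMetric S (flow Z (s + t)) q v w =
      pullbackMetric S (flow Z t) (flow Z s q) (mfderiv 𝓘(ℝ, E) 𝓘(ℝ, E) (flow Z s) q v)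
        (mfderiv 𝓘(ℝ, E) 𝓘(ℝ, E) (flow Z s) q w) := by
  unfold pullbackMetric
  rw [mfderiv_flow_add hZ hs ht, mfderiv_flow_add hZ hs ht, (flow_add hZ hs ht).2]

theorem pullbackMetric_flow_zero (q : M) (v w : TangentSpace 𝓘(ℝ, E) q) :
    pullbackMetric S (flow Z 0) q v w = S.metric q v w := by
  unfold pullbackMetric
  rw [flow_zero hZ, mfderiv_id]
  rfl

theorem eventually_mem_flowDomain (q : M) : ∀ᶠ t in 𝓝 (0 : ℝ), q ∈ flowDomain Z t := by
  obtain ⟨ε, hε, W, -, hqW, -, hW⟩ :=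
    exists_local_flow_of_contMDiff hZ q one_ne_zero (V := univ) univ_mem
  filter_upwards [Ioo_mem_nhds (neg_lt_zero.2 hε) hε] with t ht
  exact ⟨_, (hW q hqW t ht).1⟩

/-- The group law moves the derivative at time `t` to time zero at the point `ψ^t(q)`, applied to
the transported vectors, which are again horizontal. -/
theorem hasDerivAt_pullbackMetric_flow (hAd : AdPreserves S Z) {q : M} {t : ℝ}
    (ht : q ∈ flowDomain Z t) {v w : TangentSpace 𝓘(ℝ, E) q} (hv : v ∈ S.H q) (hw : w ∈ S.H q) :
    HasDerivAt (fun s => pullbackMetric S (flow Z s) q v w)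
      (restrictedLieDeriv S Z (flow Z t q) (mfderiv 𝓘(ℝ, E) 𝓘(ℝ, E) (flow Z t) q v)
        (mfderiv 𝓘(ℝ, E) 𝓘(ℝ, E) (flow Z t) q w)) t := by
  have hpres := preservesOn_flow_of_adPreserves hZ hAd t q ht
  have h1 := (differentiableAt_pullbackMetric_flow hZ hAd (hpres v hv) (hpres w hw)).hasDerivAt
  rw [← sub_self t] at h1
  refine (h1.comp_sub_const t t).congr_of_eventuallyEq ?_ |>.congr_deriv ?_
  · have h2 : Tendsto (fun s => s - t) (𝓝 t) (𝓝 0) := by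
      have : ContinuousAt (fun s => s - t) t := by fun_prop
      simpa [ContinuousAt] using this
    filter_upwards [h2.eventually (eventually_mem_flowDomain hZ (flow Z t q))] with s hs
    have := pullbackMetric_flow_add (S := S) hZ ht hs v w
    rwa [add_sub_cancel] at this
  · rw [sub_self]
    rfl

/-- If the restricted Lie derivative of the metric is `μ` times the metric, then the flow
multiplies the metric by the exponential of the integral of `μ` along the integral curves. -/
theorem pullbackMetric_flow_eq_exp (hAd : AdPreserves S Z) {μ : M → ℝ} (hμ : Continuous μ)
    (hL : ∀ q : M, ∀ v ∈ S.H q, ∀ w ∈ S.H q,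
      restrictedLieDeriv S Z q v w = μ q * S.metric q v w) {q : M} {t : ℝ}
    (ht : q ∈ flowDomain Z t) {v w : TangentSpace 𝓘(ℝ, E) q} (hv : v ∈ S.H q) (hw : w ∈ S.H q) :
    pullbackMetric S (flow Z t) q v w =
      Real.exp (∫ s in (0 : ℝ)..t, μ (flow Z s q)) * S.metric q v w := by
  obtain ⟨p, γ, a, b, h0, htI, hγ, hγ0, -⟩ := ht
  have hfl : ∀ s ∈ Ioo a b, FlowsTo Z s q (γ s) := fun s hs => by
    simpa [hγ0] using flowsTo_of_isMIntegralCurveOn hγ h0 hs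
  have hcont : ContinuousOn (fun s => μ (flow Z s q)) (Ioo a b) :=
    (hμ.comp_continuousOn hγ.continuousOn).congr fun s hs => by
      simp only [Function.comp_apply, (hfl s hs).flow_eq hZ]
  have hA : ∀ s ∈ Ioo a b, HasDerivAt (fun s => ∫ r in (0 : ℝ)..s, μ (flow Z r q))
      (μ (flow Z s q)) s := fun s hs =>
    intervalIntegral.integral_hasDerivAt_right
      ((hcont.mono (ordConnected_Ioo.uIcc_subset h0 hs)).intervalIntegrable)
      (hcont.stronglyMeasurableAtFilter isOpen_Ioo s hs) (hcont.continuousAt (Ioo_mem_nhds hs.1 hs.2))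
  -- Integrating factor for the scalar equation `y' = μ(ψ^s(q)) y` satisfied by the pulled back
  -- metric.
  have hF : ∀ s ∈ Ioo a b, HasDerivAt (fun s => Real.exp (-∫ r in (0 : ℝ)..s, μ (flow Z r q)) *
      pullbackMetric S (flow Z s) q v w) 0 s := fun s hs => by
    have hs' : q ∈ flowDomain Z s := ⟨_, hfl s hs⟩
    have hpres := preservesOn_flow_of_adPreserves hZ hAd s q hs'
    refine ((hA s hs).neg.exp.mul (hasDerivAt_pullbackMetric_flow hZ hAd hs' hv hw)).congr_deriv ?_
    rw [hL _ _ (hpres v hv) _ (hpres w hw)]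
    unfold pullbackMetric
    ring
  have hc := isOpen_Ioo.is_const_of_deriv_eq_zero isPreconnected_Ioo
    (fun s hs => (hF s hs).differentiableAt.differentiableWithinAt) (fun s hs => (hF s hs).deriv)
    htI h0
  rw [intervalIntegral.integral_same, neg_zero, Real.exp_zero, one_mul,
    pullbackMetric_flow_zero hZ, Real.exp_neg] at hc
  rw [← hc, mul_inv_cancel_left₀ (Real.exp_ne_zero _)]

/-- Smoothness of the exponential factor does not come from differentiating under the integral: near
each point the factor is a quotient of the pulled back metric by the metric, evaluated on two
horizontal fields. In rank zero there is no such quotient, and the factor `1` is used. -/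
theorem isInfinitesimalConformal_of_restrictedLieDeriv (hAd : AdPreserves S Z) {μ : M → ℝ}
    (hμ : Continuous μ) (hL : ∀ q : M, ∀ v ∈ S.H q, ∀ w ∈ S.H q,
      restrictedLieDeriv S Z q v w = μ q * S.metric q v w) : IsInfinitesimalConformal S Z := by
  intro t
  have hpres := preservesOn_flow_of_adPreserves hZ hAd t
  refine ⟨isDiffeoOn_flow hZ t, hpres, ?_⟩
  by_cases hr : S.rank = 0
  · refine ⟨fun _ => 1, contMDiffOn_const, fun _ _ => one_pos, fun q hq v hv w hw => ?_⟩
    rw [metric_eq_zero_of_rank_eq_zero hr hv hw, mul_zero]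
    exact metric_eq_zero_of_rank_eq_zero hr (hpres q hq v hv) (hpres q hq w hw)
  refine ⟨fun q => Real.exp (∫ s in (0 : ℝ)..t, μ (flow Z s q)), fun q hq => ?_,
    fun _ _ => Real.exp_pos _, fun q hq v hv w hw =>
      pullbackMetric_flow_eq_exp hZ hAd hμ hL hq hv hw⟩
  obtain ⟨v, hv, w, hw, hvw⟩ := exists_metric_ne_zero hr q
  obtain ⟨U, X, Y, hqU, hX, hY, rfl, rfl⟩ := exists_horizontal_extension₂ S hv hw
  have hm := contMDiffAt_metric hX hY hqU
  have hp := contMDiffAt_pullbackMetric (isOpen_flowDomain hZ t)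
    (fun p hp => contMDiffAt_flow hZ hp) hpres hX hY hqU hq
  refine ((hp.div₀ hm hvw).congr_of_eventuallyEq ?_).contMDiffWithinAt
  filter_upwards [(isOpen_flowDomain hZ t).mem_nhds hq, hX.1.1.mem_nhds hqU,
    hm.continuousAt.eventually_ne hvw] with p hpD hpU hpne
  rw [Pi.div_apply, pullbackMetric_flow_eq_exp hZ hAd hμ hL hpD (hX.2 p hpU) (hY.2 p hpU),
    mul_div_cancel_right₀ _ hpne]

/-- Both sides are derivatives of `ρ_t g(v, w) g(v', w')`. Cross multiplication avoids any
differentiability of `ρ_t` in `t`, which the definition does not provide. -/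
theorem restrictedLieDeriv_mul_comm_of_isInfinitesimalConformal
    (hC : IsInfinitesimalConformal S Z) (hAd : AdPreserves S Z) {q : M}
    {v w v' w' : TangentSpace 𝓘(ℝ, E) q} (hv : v ∈ S.H q) (hw : w ∈ S.H q) (hv' : v' ∈ S.H q)
    (hw' : w' ∈ S.H q) :
    restrictedLieDeriv S Z q v w * S.metric q v' w' =
      restrictedLieDeriv S Z q v' w' * S.metric q v w := by
  have h1 := (differentiableAt_pullbackMetric_flow hZ hAd hv hw).hasDerivAt.mul_const
    (S.metric q v' w')
  have h2 := (differentiableAt_pullbackMetric_flow hZ hAd hv' hw').hasDerivAt.mul_const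
    (S.metric q v w)
  refine h1.unique (h2.congr_of_eventuallyEq ?_)
  filter_upwards [eventually_mem_flowDomain hZ q] with t ht
  obtain ⟨-, -, ρ, -, -, hρ⟩ := hC t
  rw [hρ q ht v hv w hw, hρ q ht v' hv' w' hw']
  ring

theorem exists_restrictedLieDeriv_eq_mul (hC : IsInfinitesimalConformal S Z)
    (hAd : AdPreserves S Z) : ∃ μ : M → ℝ, ContMDiff 𝓘(ℝ, E) 𝓘(ℝ, ℝ) ∞ μ ∧
      ∀ q : M, ∀ v ∈ S.H q, ∀ w ∈ S.H q,
        restrictedLieDeriv S Z q v w = μ q * S.metric q v w := by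
  by_cases hr : S.rank = 0
  · refine ⟨fun _ => 0, contMDiff_const, fun q v hv w hw => ?_⟩
    rw [zero_mul]
    refine HasDerivAt.deriv ((hasDerivAt_const (0 : ℝ) (0 : ℝ)).congr_of_eventuallyEq ?_)
    filter_upwards [eventually_mem_flowDomain hZ q] with t ht
    have hpres := preservesOn_flow_of_adPreserves hZ hAd t q ht
    exact metric_eq_zero_of_rank_eq_zero hr (hpres v hv) (hpres w hw)
  choose v₀ hv₀ w₀ hw₀ hne using exists_metric_ne_zero hr
  -- The vectors are chosen pointwise without any continuity. The quotient does not depend on the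
  -- choice, so near each point it may be computed with smooth fields.
  let μ : M → ℝ := fun q => restrictedLieDeriv S Z q (v₀ q) (w₀ q) / S.metric q (v₀ q) (w₀ q)
  have hμ : ∀ q : M, ∀ v ∈ S.H q, ∀ w ∈ S.H q,
      restrictedLieDeriv S Z q v w = μ q * S.metric q v w := fun q v hv w hw => by
    rw [div_mul_eq_mul_div, eq_div_iff (hne q)]
    exact restrictedLieDeriv_mul_comm_of_isInfinitesimalConformal hZ hC hAd hv hw (hv₀ q) (hw₀ q)
  refine ⟨μ, fun q => ?_, hμ⟩
  obtain ⟨U, X, Y, hqU, hX, hY, hXq, hYq⟩ := exists_horizontal_extension₂ S (hv₀ q) (hw₀ q)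
  have hvw : S.metric q (X q) (Y q) ≠ 0 := by
    rw [hXq, hYq]
    exact hne q
  have hm := contMDiffAt_metric hX hY hqU
  have hd := ((contMDiffAt_derivMetricAlong hZ hX hY hqU).sub
    (contMDiffAt_metric (hAd U X hX) hY hqU)).sub (contMDiffAt_metric hX (hAd U Y hY) hqU)
  refine (hd.div₀ hm hvw).congr_of_eventuallyEq ?_
  filter_upwards [hX.1.1.mem_nhds hqU, hm.continuousAt.eventually_ne hvw] with p hpU hpne
  rw [Pi.div_apply, eq_div_iff hpne, ← hμ p _ (hX.2 p hpU) _ (hY.2 p hpU)]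
  exact restrictedLieDeriv_eq hZ hAd hX hY hpU

theorem isInfinitesimalConformal_iff :
    IsInfinitesimalConformal S Z ↔ AdPreserves S Z ∧
      ∃ μ : M → ℝ, ContMDiff 𝓘(ℝ, E) 𝓘(ℝ, ℝ) ∞ μ ∧ ∀ q : M, ∀ v ∈ S.H q, ∀ w ∈ S.H q,
        restrictedLieDeriv S Z q v w = μ q * S.metric q v w := by
  refine ⟨fun h => ?_, fun ⟨hAd, μ, hμ, h⟩ =>
    isInfinitesimalConformal_of_restrictedLieDeriv hZ hAd hμ.continuous h⟩
  have hAd := (adPreserves_iff hZ).2 fun t => (h t).2.1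
  exact ⟨hAd, exists_restrictedLieDeriv_eq_mul hZ h hAd⟩

theorem isInfinitesimalIsometry_iff :
    IsInfinitesimalIsometry S Z ↔ AdPreserves S Z ∧ ∀ q : M, ∀ v ∈ S.H q, ∀ w ∈ S.H q,
      restrictedLieDeriv S Z q v w = 0 := by
  refine ⟨fun h => ⟨(adPreserves_iff hZ).2 fun t => (h t).2.1, fun q v hv w hw => ?_⟩,
    fun ⟨hAd, h⟩ t => ⟨isDiffeoOn_flow hZ t, preservesOn_flow_of_adPreserves hZ hAd t,
      fun q hq v hv w hw => ?_⟩⟩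
  · refine HasDerivAt.deriv
      ((hasDerivAt_const (0 : ℝ) (S.metric q v w)).congr_of_eventuallyEq ?_)
    filter_upwards [eventually_mem_flowDomain hZ q] with t ht
    exact (h t).2.2 q ht v hv w hw
  · have := pullbackMetric_flow_eq_exp (μ := fun _ => 0) hZ hAd continuous_const
      (fun q v hv w hw => by rw [h q v hv w hw, zero_mul]) hq hv hw
    simpa using this

end FlowMetric

end SubSemiRiem
end

theorem mainTheorem2 {E : Type*} [NormedAddCommGroup E] [NormedSpace ℝ E] [FiniteDimensional ℝ E]
    {M : Type*} [TopologicalSpace M] [ChartedSpace E M] [IsManifold 𝓘(ℝ, E) ∞ M] [T2Space M]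
    (S : SubSemiRiem.SubSemiRiemannianStructure E M)
    (Z : (q : M) → TangentSpace 𝓘(ℝ, E) q)
    (hZ : ContMDiff 𝓘(ℝ, E) 𝓘(ℝ, E).tangent ∞
      (fun q => (⟨q, Z q⟩ : TangentBundle 𝓘(ℝ, E) M))) :
    -- `ad_Z` preserves `Γ(H)` if and only if the flow preserves `H`
    (SubSemiRiem.AdPreserves S Z ↔
      ∀ t : ℝ, SubSemiRiem.PreservesOn S (SubSemiRiem.flow Z t) (SubSemiRiem.flowDomain Z t)) ∧
    -- in that case the restricted Lie derivative of `g` exists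
    (SubSemiRiem.AdPreserves S Z → ∀ q : M, ∀ v ∈ S.H q, ∀ w ∈ S.H q,
      DifferentiableAt ℝ
        (fun t : ℝ => SubSemiRiem.pullbackMetric S (SubSemiRiem.flow Z t) q v w) 0) ∧
    -- the main equivalence
    (SubSemiRiem.IsInfinitesimalConformal S Z ↔
      SubSemiRiem.AdPreserves S Z ∧
      ∃ μ : M → ℝ, ContMDiff 𝓘(ℝ, E) 𝓘(ℝ, ℝ) ∞ μ ∧
        ∀ q : M, ∀ v ∈ S.H q, ∀ w ∈ S.H q,
          SubSemiRiem.restrictedLieDeriv S Z q v w = μ q * S.metric q v w) ∧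
    -- the bracket identity for infinitesimal conformal transformations
    (SubSemiRiem.IsInfinitesimalConformal S Z ↔
      SubSemiRiem.AdPreserves S Z ∧
      ∃ μ : M → ℝ, ContMDiff 𝓘(ℝ, E) 𝓘(ℝ, ℝ) ∞ μ ∧
        ∀ (U : Set M) (X Y : (q : M) → TangentSpace 𝓘(ℝ, E) q),
          SubSemiRiem.IsHorizontalOn S.H U X → SubSemiRiem.IsHorizontalOn S.H U Y → ∀ q ∈ U,
            SubSemiRiem.derivMetricAlong S Z X Y q =
              S.metric q (VectorField.mlieBracket 𝓘(ℝ, E) Z X q) (Y q) +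
              S.metric q (X q) (VectorField.mlieBracket 𝓘(ℝ, E) Z Y q) +
              μ q * S.metric q (X q) (Y q)) ∧
    -- the bracket identity for infinitesimal isometries
    (SubSemiRiem.IsInfinitesimalIsometry S Z ↔
      SubSemiRiem.AdPreserves S Z ∧
        ∀ (U : Set M) (X Y : (q : M) → TangentSpace 𝓘(ℝ, E) q),
          SubSemiRiem.IsHorizontalOn S.H U X → SubSemiRiem.IsHorizontalOn S.H U Y → ∀ q ∈ U,
            SubSemiRiem.derivMetricAlong S Z X Y q =
              S.metric q (VectorField.mlieBracket 𝓘(ℝ, E) Z X q) (Y q) +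
              S.metric q (X q) (VectorField.mlieBracket 𝓘(ℝ, E) Z Y q)) := by
  refine ⟨SubSemiRiem.adPreserves_iff hZ, fun hAd q v hv w hw =>
    SubSemiRiem.differentiableAt_pullbackMetric_flow hZ hAd hv hw,
    SubSemiRiem.isInfinitesimalConformal_iff hZ,
    (SubSemiRiem.isInfinitesimalConformal_iff hZ).trans (and_congr_right fun hAd =>
      exists_congr fun μ => and_congr_right fun _ =>
        SubSemiRiem.restrictedLieDeriv_eq_mul_iff hZ hAd μ),
    (SubSemiRiem.isInfinitesimalIsometry_iff hZ).trans (and_congr_right fun hAd => ?_)⟩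
  -- Isometries are the case `μ = 0` of the same equivalence.
  simpa using SubSemiRiem.restrictedLieDeriv_eq_mul_iff hZ hAd (fun _ => 0)
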